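/- Corollary 1. Let $P,Q\in\mathbf{C}[x,y]$ be such that the Jacobian determinant $P_xQ_y-P_yQ_x$ is a nonzero constant. Suppose that the total degrees are $\deg P=Kd$ and $\deg Q=Ke$ with $\gcd(d,e)=1$ ($K,d,e$ natural numbers), and that $P$ and $Q$ are monic in $y$ up to constants, i.e. $$P(x,y)=Ay^{Kd}+\dots+a_1(x)y+a_0(x),\qquad Q(x,y)=By^{Ke}+\dots+b_1(x)y+b_0(x),$$ with nonzero constants $A,B\in\mathbf{C}$ and lower terms in $y$ having coefficients in $\mathbf{C}[x]$. Let $R_0(u,v)\in\mathbf{C}[u,v]$ be the leading coefficient of the resultant $$\mathrm{Res}_y(P-u,Q-v)=R_0(u,v)x^N+\dots+R_N(u,v),$$ viewed as a polynomial in $x$ with coefficients in $\mathbf{C}[u,v]$. Then there are a constant $0\ne C\in\mathbf{C}$, an integer $M\ge 0$ and coefficients $c_{ij}\in\mathbf{C}$ $(i,j\ge 0)$ such that $$R_0(u,v)=C\,(B^d u^e-A^e v^d)^M+\sum_{0\le id+je<Mde}c_{ij}u^iv^j .$$ -/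

import Mathlib

/-- The Jacobian determinant `P_x Q_y - P_y Q_x` of `P, Q ∈ ℂ[x, y]`
(variable `0` is `x`, variable `1` is `y`). -/
noncomputable def jacobianDet (P Q : MvPolynomial (Fin 2) ℂ) : MvPolynomial (Fin 2) ℂ :=
  MvPolynomial.pderiv 0 P * MvPolynomial.pderiv 1 Q
    - MvPolynomial.pderiv 1 P * MvPolynomial.pderiv 0 Q

/-- A polynomial `P ∈ ℂ[x, y]` regarded as a polynomial in `y` whose coefficients are polynomials
in `x` over a commutative `ℂ`-algebra `S`, that is, as an element of `S[x][y]`.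
For `S = ℂ` this is the usual identification of `ℂ[x, y]` with `ℂ[x][y]`. -/
noncomputable def asPolyInY (S : Type*) [CommRing S] [Algebra ℂ S]
    (P : MvPolynomial (Fin 2) ℂ) : Polynomial (Polynomial S) :=
  MvPolynomial.aeval ![Polynomial.C Polynomial.X, Polynomial.X] P

/-- The resultant `Res_y (P - u, Q - v)`, as a polynomial in `x` with coefficients in `ℂ[u, v]`.
In the coefficient ring `ℂ[u, v] = MvPolynomial (Fin 2) ℂ`, variable `0` is `u` and variable `1`
is `v`. -/
noncomputable def resultantY (P Q : MvPolynomial (Fin 2) ℂ) :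
    Polynomial (MvPolynomial (Fin 2) ℂ) :=
  Polynomial.resultant
    (asPolyInY (MvPolynomial (Fin 2) ℂ) P - Polynomial.C (Polynomial.C (MvPolynomial.X 0)))
    (asPolyInY (MvPolynomial (Fin 2) ℂ) Q - Polynomial.C (Polynomial.C (MvPolynomial.X 1)))

/-! Give `u`, `v` the weights `d`, `e`. The claim is that the top weighted form of `R₀` is a
constant times a power of `B^d u^e - A^e v^d`. This binomial is prime because `gcd(d, e) = 1`
(`quasiForm_prime`), and top forms are multiplicative, so it suffices that the top form of each
irreducible factor `F` of `R₀` divides a power of it (`topForm_dvd_of_irreducible`).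

Take a generic zero `(u, v)` of `F` over an algebraically closed field `κ ⊇ k`. Vanishing of `R₀` at
`(u, v)` means that a root `y` of one polynomial escapes to infinity: with `x = 1/t` there is a
generalized power series `y(t)` along which `P → u` and `Q → v` (`exists_branch_at_infinity`). Real
exponents are convenient here, since Hahn series over `ℝ` are algebraically closed
(`HahnSeries.isAlgClosed_real`).

Let `ξ t^q` be the first term of `y` with coefficient outside `k`, and let `φ` be the part before
it. Substituting `y = φ + T` and giving `T` order `q`, the weight-zero parts of `P` and `Q` are
polynomials `p, q ∈ k[T]` with `p(ξ) = u`, `q(ξ) = v` (`exists_polynomial_curve`). Thus `F` divides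
the equation of the curve parametrized by `(p, q)`. If the degrees are `dj`, `ej` and the leading
coefficients satisfy the same relation as `A`, `B`, the top form of that equation divides a power of
the binomial (`topForm_curveResultant`).

The Jacobian condition gives this alignment (`alignedAt_of_wronskian`). Let the order `r` of `T`
grow from `-∞`, where the reductions are `A T^(Kd)` and `B T^(Ke)`, to `q`. A constant Jacobian
makes a weighted Wronskian of the two reductions constant (`wronskian_redAt_eq_C`). At negative
weight both reductions vanish at `T = 0`, so the constant is zero and the `e`-th and `d`-th powers
of the reductions are proportional (`Polynomial.C_mul_pow_eq_of_wronskian`). The relation then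
passes from their leading to their trailing terms, which are the leading terms for slightly larger
`r`. -/

section
open Polynomial

/-! ### Order estimates for generalized power series -/

/-- The generalized power series `f` has no terms of exponent below `a`. -/
def VanishesBelow {R : Type*} [Zero R] (a : ℝ) (f : HahnSeries ℝ R) : Prop :=
  ∀ s < a, f.coeff s = 0

namespace VanishesBelow

section Semiring
variable {R : Type*} [CommSemiring R] {a b : ℝ} {f g : HahnSeries ℝ R}

theorem mono (hf : VanishesBelow a f) (hab : b ≤ a) : VanishesBelow b f :=
  fun s hs => hf s (hs.trans_le hab)

theorem zero : VanishesBelow a (0 : HahnSeries ℝ R) := fun _ _ => rfl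

theorem add (hf : VanishesBelow a f) (hg : VanishesBelow a g) : VanishesBelow a (f + g) := by
  intro s hs
  simp [hf s hs, hg s hs]

theorem sum {ι : Type*} {t : Finset ι} {F : ι → HahnSeries ℝ R}
    (h : ∀ i ∈ t, VanishesBelow a (F i)) : VanishesBelow a (∑ i ∈ t, F i) := by
  intro s hs
  rw [HahnSeries.coeff_sum]
  exact Finset.sum_eq_zero fun i hi => h i hi s hs

theorem single (a : ℝ) (r : R) : VanishesBelow a (HahnSeries.single a r) :=
  fun _ hs => HahnSeries.coeff_single_of_ne hs.ne

theorem mul (hf : VanishesBelow a f) (hg : VanishesBelow b g) : VanishesBelow (a + b) (f * g) := by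
  intro s hs
  rw [HahnSeries.coeff_mul]
  refine Finset.sum_eq_zero fun ij hij => ?_
  rw [Finset.mem_antidiagonal] at hij
  rcases lt_or_ge ij.1 a with h | h
  · rw [hf _ h, zero_mul]
  · rw [hg ij.2 (by linarith [hij.2.2]), mul_zero]

theorem coeff_mul_add (hf : VanishesBelow a f) (hg : VanishesBelow b g) :
    (f * g).coeff (a + b) = f.coeff a * g.coeff b := by
  classical
  rw [HahnSeries.coeff_mul]
  rw [Finset.sum_eq_single (a, b)]
  · rintro ⟨i, j⟩ hij hne
    rw [Finset.mem_antidiagonal] at hij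
    obtain ⟨-, -, h⟩ := hij
    simp only at h ⊢
    rcases lt_or_ge i a with h1 | h1
    · rw [hf _ h1, zero_mul]
    · rcases h1.eq_or_lt with h2 | h2
      · exact absurd (Prod.ext h2.symm (by simp only; linarith)) hne
      · rw [hg j (by linarith), mul_zero]
  · intro h
    rw [Finset.mem_antidiagonal] at h
    simp only [HahnSeries.mem_support, and_true, not_and_or, not_not] at h
    rcases h with h | h <;> simp [h]

theorem one : VanishesBelow 0 (1 : HahnSeries ℝ R) :=
  fun s hs => by simp [HahnSeries.coeff_one, hs.ne]

theorem pow (hf : VanishesBelow a f) (n : ℕ) : VanishesBelow (n * a) (f ^ n) := by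
  induction n with
  | zero => simpa using one
  | succ n ih =>
    rw [pow_succ]
    have := ih.mul hf
    convert this using 1
    push_cast; ring

theorem coeff_pow (hf : VanishesBelow a f) (n : ℕ) :
    (f ^ n).coeff (n * a) = f.coeff a ^ n := by
  induction n with
  | zero => simp [HahnSeries.coeff_one]
  | succ n ih =>
    rw [pow_succ, pow_succ, ← ih, ← (hf.pow n).coeff_mul_add hf]
    congr 1
    push_cast; ring

theorem order : VanishesBelow f.order f := fun _ hs => HahnSeries.coeff_eq_zero_of_lt_order hs

theorem le_order (hf : VanishesBelow a f) (h0 : f ≠ 0) : a ≤ f.order := by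
  by_contra! h
  exact HahnSeries.coeff_order_eq_zero.not.mpr h0 (hf _ h)

end Semiring

theorem sub {R : Type*} [CommRing R] {a : ℝ} {f g : HahnSeries ℝ R} (hf : VanishesBelow a f)
    (hg : VanishesBelow a g) : VanishesBelow a (f - g) := by
  intro s hs
  simp [hf s hs, hg s hs]

end VanishesBelow

/-! ### Gauss weights and reductions of polynomials over generalized power series -/

section Reduction
variable {R : Type*} [CommSemiring R]

/-- All terms of `g` have order at least `w` when the variable is given order `r`. -/
def GaussLE (g : (HahnSeries ℝ R)[X]) (r w : ℝ) : Prop :=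
  ∀ i : ℕ, VanishesBelow (w - i * r) (g.coeff i)

/-- The part of `g` of order exactly `w` when the variable is given order `r`. -/
noncomputable def redAt (g : (HahnSeries ℝ R)[X]) (r w : ℝ) : R[X] :=
  ∑ i ∈ g.support, monomial i ((g.coeff i).coeff (w - i * r))

@[simp]
theorem coeff_redAt (g : (HahnSeries ℝ R)[X]) (r w : ℝ) (i : ℕ) :
    (redAt g r w).coeff i = (g.coeff i).coeff (w - i * r) := by
  classical
  simp only [redAt, finsetSum_coeff, coeff_monomial]
  rw [Finset.sum_ite_eq']
  split_ifs with h
  · rfl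
  · rw [notMem_support_iff.mp h]; rfl

variable {g h : (HahnSeries ℝ R)[X]} {r w w' : ℝ}

theorem GaussLE.mono (hg : GaussLE g r w) (hw : w' ≤ w) : GaussLE g r w' :=
  fun i => (hg i).mono (by linarith)

theorem GaussLE.redAt_eq_zero (hg : GaussLE g r w) (hw : w' < w) : redAt g r w' = 0 := by
  ext i
  rw [coeff_redAt, hg i _ (by linarith)]
  simp

/-- Gauss's lemma: in each product of coefficients only the two lowest possible exponents can meet
at the extreme exponent. -/
theorem GaussLE.redAt_mul (hg : GaussLE g r w) (hh : GaussLE h r w') :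
    redAt (g * h) r (w + w') = redAt g r w * redAt h r w' := by
  ext i
  rw [coeff_redAt, coeff_mul, coeff_mul, HahnSeries.coeff_sum]
  refine Finset.sum_congr rfl fun x hx => ?_
  rw [Finset.HasAntidiagonal.mem_antidiagonal] at hx
  rw [coeff_redAt, coeff_redAt, ← (hg x.1).coeff_mul_add (hh x.2)]
  congr 1
  rw [← hx]; push_cast; ring

theorem GaussLE.eval {δ : HahnSeries ℝ R} (hg : GaussLE g r w) (hδ : VanishesBelow r δ) :
    VanishesBelow w (g.eval δ) := by
  rw [eval_eq_sum_range]
  refine VanishesBelow.sum fun i _ => ((hg i).mul (hδ.pow i)).mono (le_of_eq ?_)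
  ring

theorem GaussLE.coeff_eval {δ : HahnSeries ℝ R} (hg : GaussLE g r w) (hδ : VanishesBelow r δ) :
    (g.eval δ).coeff w = (redAt g r w).eval (δ.coeff r) := by
  have hd : (redAt g r w).natDegree < g.natDegree + 1 := by
    rw [Nat.lt_succ_iff, natDegree_le_iff_coeff_eq_zero]
    intro N hN
    rw [coeff_redAt, coeff_eq_zero_of_natDegree_lt hN]; rfl
  rw [eval_eq_sum_range, eval_eq_sum_range' hd, HahnSeries.coeff_sum]
  refine Finset.sum_congr rfl fun i _ => ?_
  rw [coeff_redAt, ← hδ.coeff_pow, ← (hg i).coeff_mul_add (hδ.pow i)]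
  congr 1
  ring

theorem natCast_mul_coeff (n : ℕ) (f : HahnSeries ℝ R) (s : ℝ) :
    ((n : HahnSeries ℝ R) * f).coeff s = n * f.coeff s := by
  rw [← HahnSeries.single_zero_natCast, HahnSeries.coeff_single_zero_mul]

theorem GaussLE.hasseDeriv (hg : GaussLE g r w) (k : ℕ) :
    GaussLE (hasseDeriv k g) r (w - k * r) := by
  intro i s hs
  rw [hasseDeriv_coeff, natCast_mul_coeff, hg (i + k) s (by push_cast; linarith), mul_zero]

theorem redAt_hasseDeriv (k : ℕ) :
    redAt (hasseDeriv k g) r (w - k * r) = hasseDeriv k (redAt g r w) := by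
  ext i
  rw [coeff_redAt, hasseDeriv_coeff, natCast_mul_coeff, hasseDeriv_coeff, coeff_redAt]
  congr 2
  push_cast; ring

/-- Taylor coefficients are values of Hasse derivatives, and reduction commutes with both. So
recentring inside the disc only translates the reduction. -/
theorem GaussLE.redAt_taylor {δ : HahnSeries ℝ R} (hg : GaussLE g r w)
    (hδ : VanishesBelow r δ) :
    redAt (Polynomial.taylor δ g) r w = Polynomial.taylor (δ.coeff r) (redAt g r w) := by
  ext i
  rw [coeff_redAt, taylor_coeff, taylor_coeff, (hg.hasseDeriv i).coeff_eval hδ, redAt_hasseDeriv]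

/-- The right weight is the minimum of `ord (g_i) + i r` over the finite support. -/
theorem exists_gaussLE_redAt_ne_zero (hg : g ≠ 0) (r : ℝ) :
    ∃ w, GaussLE g r w ∧ redAt g r w ≠ 0 := by
  obtain ⟨n, hn, hmin⟩ := g.support.exists_min_image
    (fun i => (g.coeff i).order + i * r) (nonempty_support_iff.mpr hg)
  refine ⟨(g.coeff n).order + n * r, fun i => ?_, fun h => ?_⟩
  · by_cases hi : g.coeff i = 0
    · rw [hi]; exact VanishesBelow.zero
    · have := hmin i (mem_support_iff.mpr hi)
      exact VanishesBelow.order.mono (by linarith)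
  · have := congrArg (fun p => p.coeff n) h
    simp only [coeff_redAt, coeff_zero, add_sub_cancel_right, HahnSeries.coeff_order_eq_zero] at this
    exact mem_support_iff.mp hn this

end Reduction

/-! ### Newton polygons and algebraic closedness of Hahn series -/

/-- The Newton polygon of `g` shows a root of order at least `q`. -/
def HasRootDisc {k : Type*} [Field k] (g : (HahnSeries ℝ k)[X]) (q : ℝ) : Prop :=
  ∃ i ∈ g.support.erase 0, (g.coeff i).order + i * q ≤ (g.coeff 0).order

section
variable {k : Type*} [Field k] {g : (HahnSeries ℝ k)[X]} {q : ℝ}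

theorem HasRootDisc.exists_gaussLE (h : HasRootDisc g q) :
    ∃ w, GaussLE g q w ∧ redAt g q w ≠ 0 ∧ (redAt g q w).natDegree ≠ 0 := by
  obtain ⟨i, hi, hle⟩ := h
  rw [Finset.mem_erase, mem_support_iff] at hi
  have hg : g ≠ 0 := by rintro rfl; exact hi.2 rfl
  obtain ⟨w, hw, hne⟩ := exists_gaussLE_redAt_ne_zero hg q
  refine ⟨w, hw, hne, fun h0 => ?_⟩
  rw [eq_C_of_natDegree_eq_zero h0] at hne
  have hc : (g.coeff 0).coeff w ≠ 0 := by simpa using hne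
  have h1 := HahnSeries.order_le_of_coeff_ne_zero hc
  have h2 : (redAt g q w).coeff i = 0 :=
    coeff_eq_zero_of_natDegree_lt (by rw [h0]; exact Nat.pos_of_ne_zero hi.1)
  rw [coeff_redAt] at h2
  have h3 := (hw i).le_order hi.2
  have h4 : (g.coeff i).order = w - i * q := by linarith
  rw [← h4, HahnSeries.coeff_order_eq_zero] at h2
  exact hi.2 h2

/-- The constant term must be nonzero because `order` takes the default value `0` at the zero
series. -/
theorem hasRootDisc_of_natDegree_redAt {w : ℝ} (hw : VanishesBelow w (g.coeff 0))
    (h0 : g.coeff 0 ≠ 0) (hne : (redAt g q w).natDegree ≠ 0) : HasRootDisc g q := by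
  have hc : (redAt g q w).coeff (redAt g q w).natDegree ≠ 0 := by
    rw [coeff_natDegree, Ne, leadingCoeff_eq_zero]
    rintro h
    rw [h] at hne
    simp at hne
  set n := (redAt g q w).natDegree
  rw [coeff_redAt] at hc
  have h1 := HahnSeries.order_le_of_coeff_ne_zero hc
  refine ⟨n, Finset.mem_erase.mpr ⟨hne, mem_support_iff.mpr (by rintro h; simp [h] at hc)⟩, ?_⟩
  have := hw.le_order h0
  linarith

/-- A root disc is detected by the degree of the reduction, which recentring by `δ` does not change.
-/
theorem HasRootDisc.taylor (h : HasRootDisc g q) {δ : HahnSeries ℝ k} (hδ : VanishesBelow q δ)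
    (h0 : g.eval δ ≠ 0) : HasRootDisc (taylor δ g) q := by
  obtain ⟨w, hw, -, hdeg⟩ := h.exists_gaussLE
  refine hasRootDisc_of_natDegree_redAt (w := w) ?_ ?_ ?_
  · rw [taylor_coeff_zero]; exact hw.eval hδ
  · rwa [taylor_coeff_zero]
  · rwa [hw.redAt_taylor hδ, natDegree_taylor]

theorem isClosed_hasRootDisc (g : (HahnSeries ℝ k)[X]) : IsClosed {q | HasRootDisc g q} := by
  have : {q | HasRootDisc g q} =
      ⋃ i ∈ g.support.erase 0, {q : ℝ | (g.coeff i).order + i * q ≤ (g.coeff 0).order} := by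
    ext q; simp [HasRootDisc]
  rw [this]
  exact (g.support.erase 0).finite_toSet.isClosed_biUnion fun i _ =>
    isClosed_le (by fun_prop) continuous_const

theorem bddAbove_hasRootDisc (g : (HahnSeries ℝ k)[X]) : BddAbove {q | HasRootDisc g q} := by
  have : {q | HasRootDisc g q} =
      ⋃ i ∈ g.support.erase 0, {q : ℝ | (g.coeff i).order + i * q ≤ (g.coeff 0).order} := by
    ext q; simp [HasRootDisc]
  rw [this]
  refine (Set.Finite.bddAbove_biUnion (g.support.erase 0).finite_toSet).mpr ?_
  intro i hi
  have hi0 : (0 : ℝ) < i := by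
    have := (Finset.mem_erase.mp (Finset.mem_coe.mp hi)).1
    exact_mod_cast Nat.pos_of_ne_zero this
  refine ⟨((g.coeff 0).order - (g.coeff i).order) / i, fun q hq => ?_⟩
  rw [le_div_iff₀ hi0]
  have : (g.coeff i).order + i * q ≤ (g.coeff 0).order := hq
  linarith

/-- A Newton polygon step: a better approximation to a root. -/
theorem HasRootDisc.exists_improvement [IsAlgClosed k] (h : HasRootDisc g q)
    (hroot : ∀ z, g.eval z ≠ 0) :
    ∃ δ q', VanishesBelow q δ ∧ q < q' ∧ HasRootDisc (Polynomial.taylor δ g) q' := by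
  set S := {q | HasRootDisc g q}
  have hS : sSup S ∈ S := (isClosed_hasRootDisc g).csSup_mem ⟨q, h⟩ (bddAbove_hasRootDisc g)
  have hq : q ≤ sSup S := le_csSup (bddAbove_hasRootDisc g) h
  have hmax : ∀ q' ∈ S, q' ≤ sSup S := fun q' hq' => le_csSup (bddAbove_hasRootDisc g) hq'
  set q₁ := sSup S
  obtain ⟨w, hw, hne, hdeg⟩ := HasRootDisc.exists_gaussLE (show HasRootDisc g q₁ from hS)
  -- At the largest admissible radius, a root `c` of the reduction kills the weight-`w` part of the
  -- constant term after translation, so its order exceeds `w`.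
  obtain ⟨c, hc⟩ := IsAlgClosed.exists_root (redAt g q₁ w)
    (fun h => hdeg (natDegree_eq_of_degree_eq_some h))
  set δ := HahnSeries.single q₁ c
  have hδ : VanishesBelow q₁ δ := VanishesBelow.single q₁ c
  have hδc : δ.coeff q₁ = c := HahnSeries.coeff_single_same _ _
  have hv := hw.eval hδ
  have hv' := hw.coeff_eval hδ
  rw [hδc, hc.eq_zero] at hv'
  have hord : w < (g.eval δ).order := by
    refine lt_of_le_of_ne (hv.le_order (hroot δ)) fun h => ?_
    rw [h, HahnSeries.coeff_order_eq_zero] at hv'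
    exact hroot δ hv'
  have hr := hw.redAt_taylor hδ
  set n := (redAt g q₁ w).natDegree with hn
  have hcn : (redAt (Polynomial.taylor δ g) q₁ w).coeff n ≠ 0 := by
    rw [hr, hδc, hn, ← natDegree_taylor (redAt g q₁ w) c, coeff_natDegree, Ne,
      leadingCoeff_eq_zero, taylor_eq_zero]
    exact hne
  rw [coeff_redAt] at hcn
  have h1 := HahnSeries.order_le_of_coeff_ne_zero hcn
  have hn0 : (0 : ℝ) < n := by exact_mod_cast Nat.pos_of_ne_zero hdeg
  -- The gain in order of the constant term is shared among the `n` roots counted by the surviving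
  -- degree-`n` coefficient.
  refine ⟨δ, q₁ + ((g.eval δ).order - w) / n, hδ.mono hq, ?_, n, ?_, ?_⟩
  · have : 0 < ((g.eval δ).order - w) / n := by apply div_pos <;> linarith
    linarith
  · exact Finset.mem_erase.mpr ⟨hdeg, mem_support_iff.mpr (by rintro h; simp [h] at hcn)⟩
  · rw [taylor_coeff_zero, mul_add, mul_div_cancel₀ _ hn0.ne']
    linarith

/-- Spherical completeness: compatible approximations have a common refinement. -/
theorem HahnSeries.exists_common_approximation {ι : Type*} {R : Type*} [CommRing R]
    (y : ι → HahnSeries ℝ R) (q : ι → ℝ)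
    (h : ∀ a b, q a ≤ q b → VanishesBelow (q a) (y b - y a)) :
    ∃ z, ∀ a, VanishesBelow (q a) (z - y a) := by
  classical
  have hcomp : ∀ a b s, s < q a → s < q b → (y a).coeff s = (y b).coeff s := by
    intro a b s ha hb
    rcases le_total (q a) (q b) with hab | hab
    · have := h a b hab s ha
      rw [HahnSeries.coeff_sub, sub_eq_zero] at this
      exact this.symm
    · have := h b a hab s hb
      rw [HahnSeries.coeff_sub, sub_eq_zero] at this
      exact this
  let F : ℝ → R := fun s => if hs : ∃ a, s < q a then (y hs.choose).coeff s else 0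
  have hF : ∀ a s, s < q a → F s = (y a).coeff s := by
    intro a s ha
    have hs : ∃ a, s < q a := ⟨a, ha⟩
    simp only [F, dif_pos hs]
    exact hcomp _ _ _ hs.choose_spec ha
  have hWF : (Function.support F).IsWF := by
    rw [Set.isWF_iff_no_descending_seq]
    rintro f hf hsub
    have h0 : F (f 0) ≠ 0 := hsub 0
    obtain ⟨a, ha⟩ : ∃ a, f 0 < q a := by
      by_contra h'
      exact h0 (dif_neg h')
    -- A descending sequence stays below its first term, hence lies in the support of a single `y
    -- a`.
    refine Set.isWF_iff_no_descending_seq.mp (y a).isWF_support f hf fun n => ?_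
    have hn : F (f n) ≠ 0 := hsub n
    rwa [hF a _ ((hf.antitone (Nat.zero_le n)).trans_lt ha)] at hn
  refine ⟨⟨F, hWF.isPWO⟩, fun a s hs => ?_⟩
  rw [HahnSeries.coeff_sub, sub_eq_zero]
  exact hF a s hs

end

/-- Generalized power series with real exponents over an algebraically closed field form an
algebraically closed field. -/
theorem HahnSeries.isAlgClosed_real (k : Type*) [Field k] [IsAlgClosed k] :
    IsAlgClosed (HahnSeries ℝ k) := by
  refine IsAlgClosed.of_exists_root _ fun f hmonic hirr => ?_
  by_contra! hroot
  have hroot' : ∀ y z, (Polynomial.taylor y f).eval z ≠ 0 := fun y z => by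
    rw [taylor_eval]; exact hroot _
  have hdeg : f.natDegree ≠ 0 := hirr.natDegree_pos.ne'
  -- Zorn's lemma runs over pairs of a centre and a radius. Without a root, a maximal pair would be
  -- contradicted by a Newton step.
  let T := {p : HahnSeries ℝ k × ℝ // HasRootDisc (Polynomial.taylor p.1 f) p.2}
  have hT : Nonempty T := by
    have h0 : f.coeff 0 ≠ 0 := by rw [coeff_zero_eq_eval_zero]; exact hroot 0
    refine ⟨⟨(0, (f.coeff 0).order / f.natDegree), f.natDegree,
      Finset.mem_erase.mpr ⟨hdeg, ?_⟩, ?_⟩⟩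
    · simp [hmonic.ne_zero]
    · have : (f.natDegree : ℝ) ≠ 0 := by exact_mod_cast hdeg
      simp [hmonic.coeff_natDegree, mul_div_cancel₀ _ this]
  let r : T → T → Prop := fun a b => a.1.2 ≤ b.1.2 ∧ VanishesBelow a.1.2 (b.1.1 - a.1.1)
  have htrans : ∀ {a b c : T}, r a b → r b c → r a c := by
    rintro a b c ⟨h1, h2⟩ ⟨h3, h4⟩
    refine ⟨h1.trans h3, ?_⟩
    have := (h4.mono h1).add h2
    rwa [sub_add_sub_cancel] at this
  have hrefl : ∀ a : T, r a a := fun a => ⟨le_rfl, by rw [sub_self]; exact VanishesBelow.zero⟩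
  have hmax : ∃ m, ∀ a, r m a → r a m := by
    refine exists_maximal_of_nonempty_chains_bounded (fun c hc hne => ?_) htrans
    obtain ⟨z, hz⟩ := HahnSeries.exists_common_approximation (fun a : c => a.1.1.1)
      (fun a : c => a.1.1.2) (fun a b hab => by
        rcases eq_or_ne a b with rfl | hne
        · rw [sub_self]; exact VanishesBelow.zero
        rcases hc a.2 b.2 (Subtype.coe_injective.ne hne) with h | h
        · exact h.2
        · have h' := VanishesBelow.zero.sub (h.2.mono hab)
          rwa [zero_sub, neg_sub] at h')
    have hmem : ∀ a ∈ c, HasRootDisc (Polynomial.taylor z f) a.1.2 := by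
      intro a ha
      have := a.2.taylor (hz ⟨a, ha⟩) (hroot' _ _)
      rwa [taylor_taylor, sub_add_cancel] at this
    set S := (fun a : T => a.1.2) '' c
    have hS : S ⊆ {q | HasRootDisc (Polynomial.taylor z f) q} := by
      rintro _ ⟨a, ha, rfl⟩
      exact hmem a ha
    have hbdd : BddAbove S := (bddAbove_hasRootDisc _).mono hS
    -- The supremum of the radii in the chain still works, since the admissible radii form a closed
    -- set.
    have hsup : HasRootDisc (Polynomial.taylor z f) (sSup S) :=
      (isClosed_hasRootDisc _).closure_subset_iff.mpr hS
        (csSup_mem_closure (hne.image _) hbdd)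
    exact ⟨⟨(z, sSup S), hsup⟩, fun a ha => ⟨le_csSup hbdd ⟨a, ha, rfl⟩, hz ⟨a, ha⟩⟩⟩
  obtain ⟨m, hm⟩ := hmax
  obtain ⟨δ, q', hδ, hlt, hd⟩ := m.2.exists_improvement (hroot' _)
  rw [taylor_taylor] at hd
  have h1 := hm ⟨(δ + m.1.1, q'), hd⟩ ⟨hlt.le, by simpa using hδ⟩
  exact absurd h1.1 (not_le.mpr hlt)

/-! ### The Jacobian condition after substituting `x = 1/t`, `y = φ + T` -/

section Jacobian
variable {k : Type*} [Field k]

section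
variable [Algebra ℝ k]

/-- The Euler derivation `t d/dt` on generalized power series. -/
noncomputable def eulerDeriv (f : HahnSeries ℝ k) : HahnSeries ℝ k :=
  ⟨fun s => algebraMap ℝ k s * f.coeff s, f.isPWO_support.mono fun _ hs => right_ne_zero_of_mul hs⟩

theorem coeff_eulerDeriv (f : HahnSeries ℝ k) (s : ℝ) :
    (eulerDeriv f).coeff s = algebraMap ℝ k s * f.coeff s := rfl

theorem support_eulerDeriv_subset (f : HahnSeries ℝ k) : (eulerDeriv f).support ⊆ f.support :=
  fun _ hs => right_ne_zero_of_mul hs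

theorem eulerDeriv_add (f g : HahnSeries ℝ k) :
    eulerDeriv (f + g) = eulerDeriv f + eulerDeriv g := by
  ext s
  simp [coeff_eulerDeriv, mul_add]

theorem eulerDeriv_zero : eulerDeriv (0 : HahnSeries ℝ k) = 0 := by
  ext s
  simp [coeff_eulerDeriv]

theorem eulerDeriv_mul (f g : HahnSeries ℝ k) :
    eulerDeriv (f * g) = eulerDeriv f * g + f * eulerDeriv g := by
  ext s
  rw [coeff_eulerDeriv, HahnSeries.coeff_add,
    HahnSeries.coeff_mul_left' f.isPWO_support (support_eulerDeriv_subset f),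
    HahnSeries.coeff_mul_right' g.isPWO_support (support_eulerDeriv_subset g),
    HahnSeries.coeff_mul, Finset.mul_sum, ← Finset.sum_add_distrib]
  refine Finset.sum_congr rfl fun x hx => ?_
  rw [Finset.mem_antidiagonal] at hx
  rw [coeff_eulerDeriv, coeff_eulerDeriv, ← hx.2.2]
  rw [map_add]; ring

theorem eulerDeriv_single (a : ℝ) (c : k) :
    eulerDeriv (HahnSeries.single a c) = HahnSeries.single a (algebraMap ℝ k a * c) := by
  ext s
  rw [coeff_eulerDeriv, HahnSeries.coeff_single, HahnSeries.coeff_single]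
  split_ifs with h
  · rw [h]
  · simp

theorem VanishesBelow.eulerDeriv {a : ℝ} {f : HahnSeries ℝ k} (hf : VanishesBelow a f) :
    VanishesBelow a (eulerDeriv f) := fun s hs => by simp [coeff_eulerDeriv, hf s hs]

/-- The coefficientwise Euler derivation on polynomials over generalized power series. -/
noncomputable def eulerCoeff (F : (HahnSeries ℝ k)[X]) : (HahnSeries ℝ k)[X] :=
  ∑ i ∈ F.support, monomial i (eulerDeriv (F.coeff i))

@[simp]
theorem coeff_eulerCoeff (F : (HahnSeries ℝ k)[X]) (i : ℕ) :
    (eulerCoeff F).coeff i = eulerDeriv (F.coeff i) := by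
  simp only [eulerCoeff, finsetSum_coeff, coeff_monomial]
  rw [Finset.sum_ite_eq']
  split_ifs with h
  · rfl
  · rw [notMem_support_iff.mp h, eulerDeriv_zero]

theorem eulerCoeff_add (F G : (HahnSeries ℝ k)[X]) :
    eulerCoeff (F + G) = eulerCoeff F + eulerCoeff G := by
  ext1 i; simp [eulerDeriv_add]

theorem eulerDeriv_sum {ι : Type*} (t : Finset ι) (f : ι → HahnSeries ℝ k) :
    eulerDeriv (∑ i ∈ t, f i) = ∑ i ∈ t, eulerDeriv (f i) :=
  map_sum (AddMonoidHom.mk' eulerDeriv eulerDeriv_add) f t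

theorem eulerCoeff_mul (F G : (HahnSeries ℝ k)[X]) :
    eulerCoeff (F * G) = eulerCoeff F * G + F * eulerCoeff G := by
  ext1 i
  rw [coeff_eulerCoeff, coeff_add, coeff_mul, coeff_mul, coeff_mul, eulerDeriv_sum,
    ← Finset.sum_add_distrib]
  exact Finset.sum_congr rfl fun x _ => by simp [eulerDeriv_mul]

theorem eulerCoeff_C (f : HahnSeries ℝ k) : eulerCoeff (C f) = C (eulerDeriv f) := by
  ext1 i
  rw [coeff_eulerCoeff, coeff_C, coeff_C]
  split_ifs
  · rfl
  · exact eulerDeriv_zero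

theorem eulerCoeff_X : eulerCoeff (X : (HahnSeries ℝ k)[X]) = 0 := by
  ext1 i
  rw [coeff_eulerCoeff, coeff_X, coeff_zero]
  split_ifs
  · rw [← HahnSeries.single_zero_one, eulerDeriv_single]; simp
  · exact eulerDeriv_zero

theorem GaussLE.eulerCoeff {F : (HahnSeries ℝ k)[X]} {r w : ℝ} (hF : GaussLE F r w) :
    GaussLE (eulerCoeff F) r w := fun i => by
  rw [coeff_eulerCoeff]; exact (hF i).eulerDeriv

/-- Euler's identity: the coefficient of `T^i` enters with exponent `w - i r`, so `t d/dt` acts on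
the reduction as `w - r T d/dT`. -/
theorem redAt_eulerCoeff (F : (HahnSeries ℝ k)[X]) (r w : ℝ) :
    redAt (eulerCoeff F) r w =
      C (algebraMap ℝ k w) * redAt F r w - C (algebraMap ℝ k r) * (X * derivative (redAt F r w)) := by
  ext i
  rw [coeff_redAt, coeff_eulerCoeff, coeff_eulerDeriv, coeff_sub, coeff_C_mul, coeff_C_mul,
    coeff_redAt]
  cases i with
  | zero => simp
  | succ n =>
    rw [coeff_X_mul, coeff_derivative, coeff_redAt]
    rw [map_sub, map_mul, map_natCast]; push_cast; ring

end

theorem GaussLE.derivative {F : (HahnSeries ℝ k)[X]} {r w : ℝ} (hF : GaussLE F r w) :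
    GaussLE (derivative F) r (w - r) := by
  have := hF.hasseDeriv 1
  rwa [hasseDeriv_one, Nat.cast_one, one_mul] at this

theorem redAt_derivative (F : (HahnSeries ℝ k)[X]) (r w : ℝ) :
    redAt (derivative F) r (w - r) = derivative (redAt F r w) := by
  have := redAt_hasseDeriv (g := F) (r := r) (w := w) 1
  rwa [hasseDeriv_one, hasseDeriv_one, Nat.cast_one, one_mul] at this

/-- Substitution `x = 1/t`, `y = φ(t) + T` for a generalized power series `φ`. -/
noncomputable def puiseuxSubst (φ : HahnSeries ℝ k) :
    MvPolynomial (Fin 2) k →+* (HahnSeries ℝ k)[X] :=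
  MvPolynomial.eval₂Hom (C.comp HahnSeries.C) ![C (HahnSeries.single (-1) 1), C φ + X]

theorem puiseuxSubst_C (φ : HahnSeries ℝ k) (c : k) :
    puiseuxSubst φ (MvPolynomial.C c) = C (HahnSeries.single 0 c) := by
  simp [puiseuxSubst, HahnSeries.C_apply]

theorem puiseuxSubst_X_zero (φ : HahnSeries ℝ k) :
    puiseuxSubst φ (MvPolynomial.X 0) = C (HahnSeries.single (-1) 1) := by
  simp [puiseuxSubst]

theorem puiseuxSubst_X_one (φ : HahnSeries ℝ k) :
    puiseuxSubst φ (MvPolynomial.X 1) = C φ + X := by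
  simp [puiseuxSubst]

theorem derivative_puiseuxSubst (φ : HahnSeries ℝ k) (P : MvPolynomial (Fin 2) k) :
    derivative (puiseuxSubst φ P) = puiseuxSubst φ (MvPolynomial.pderiv 1 P) := by
  induction P using MvPolynomial.induction_on with
  | C a => simp [puiseuxSubst_C]
  | add p q hp hq => simp only [map_add, hp, hq]
  | mul_X p i hp =>
    rw [map_mul, derivative_mul, hp]
    fin_cases i
    · simp [MvPolynomial.pderiv_X, puiseuxSubst_X_zero, mul_comm]
    · simp [MvPolynomial.pderiv_X, puiseuxSubst_X_one]
      ring

variable [Algebra ℝ k]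

theorem eulerCoeff_puiseuxSubst (φ : HahnSeries ℝ k) (P : MvPolynomial (Fin 2) k) :
    eulerCoeff (puiseuxSubst φ P) =
      puiseuxSubst φ (MvPolynomial.pderiv 0 P) * C (HahnSeries.single (-1) (-1)) +
        puiseuxSubst φ (MvPolynomial.pderiv 1 P) * C (eulerDeriv φ) := by
  induction P using MvPolynomial.induction_on with
  | C a =>
    rw [puiseuxSubst_C, eulerCoeff_C, eulerDeriv_single]
    simp
  | add p q hp hq => simp only [map_add, eulerCoeff_add, hp, hq]; ring
  | mul_X p i hp =>
    rw [map_mul, eulerCoeff_mul, hp]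
    fin_cases i
    · have h : eulerCoeff (puiseuxSubst φ (MvPolynomial.X 0)) =
          C (HahnSeries.single (-1) (-1)) := by
        rw [puiseuxSubst_X_zero, eulerCoeff_C, eulerDeriv_single]; simp
      simp only [Fin.zero_eta, h]
      simp [MvPolynomial.pderiv_X]
      ring
    · have h : eulerCoeff (puiseuxSubst φ (MvPolynomial.X 1)) = C (eulerDeriv φ) := by
        rw [puiseuxSubst_X_one, eulerCoeff_add, eulerCoeff_C, eulerCoeff_X, add_zero]
      simp only [Fin.mk_one, h]
      simp [MvPolynomial.pderiv_X]
      ring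

/-- Chain rule: `t d/dt` sends `1/t` to `-1/t`, and the terms containing the derivative of `φ`
cancel. -/
theorem puiseuxSubst_jacobian (φ : HahnSeries ℝ k) (P Q : MvPolynomial (Fin 2) k) :
    eulerCoeff (puiseuxSubst φ P) * derivative (puiseuxSubst φ Q) -
      derivative (puiseuxSubst φ P) * eulerCoeff (puiseuxSubst φ Q) =
    puiseuxSubst φ (MvPolynomial.pderiv 0 P * MvPolynomial.pderiv 1 Q -
      MvPolynomial.pderiv 1 P * MvPolynomial.pderiv 0 Q) * C (HahnSeries.single (-1) (-1)) := by
  rw [eulerCoeff_puiseuxSubst, eulerCoeff_puiseuxSubst, derivative_puiseuxSubst,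
    derivative_puiseuxSubst, map_sub, map_mul, map_mul]
  ring

/-- Reduce the Jacobian identity at weight `a + b - r`. Its right side is free of `T`, and on the
left the two `r T p' q'` terms cancel. -/
theorem wronskian_redAt_eq_C (φ : HahnSeries ℝ k) {P Q : MvPolynomial (Fin 2) k}
    (hJ : ∃ c : k, MvPolynomial.pderiv 0 P * MvPolynomial.pderiv 1 Q -
      MvPolynomial.pderiv 1 P * MvPolynomial.pderiv 0 Q = MvPolynomial.C c) {r a b : ℝ}
    (hP : GaussLE (puiseuxSubst φ P) r a) (hQ : GaussLE (puiseuxSubst φ Q) r b) :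
    ∃ c : k, C (algebraMap ℝ k a) * redAt (puiseuxSubst φ P) r a * derivative (redAt (puiseuxSubst φ Q) r b) -
      C (algebraMap ℝ k b) * derivative (redAt (puiseuxSubst φ P) r a) * redAt (puiseuxSubst φ Q) r b = C c := by
  obtain ⟨c, hc⟩ := hJ
  have h := puiseuxSubst_jacobian φ P Q
  rw [hc, puiseuxSubst_C, ← C_mul] at h
  set h0 : HahnSeries ℝ k := HahnSeries.single 0 c * HahnSeries.single (-1) (-1)
  have h1 := hP.eulerCoeff.redAt_mul hQ.derivative
  have h2 := hP.derivative.redAt_mul hQ.eulerCoeff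
  rw [redAt_eulerCoeff, redAt_derivative] at h1 h2
  refine ⟨h0.coeff (a + b - r), ?_⟩
  have h3 : redAt (C h0) r (a + b - r) = C (h0.coeff (a + b - r)) := by
    ext i
    rw [coeff_redAt, coeff_C, coeff_C]
    split_ifs with hi
    · simp [hi]
    · rfl
  rw [← h3, ← h]
  have h4 : ∀ F G : (HahnSeries ℝ k)[X], ∀ w, redAt (F - G) r w = redAt F r w - redAt G r w := by
    intro F G w; ext i; simp
  rw [h4, show a + b - r = a + (b - r) by ring, h1, show a + (b - r) = (a - r) + b by ring, h2]
  ring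

end Jacobian

/-! ### Proportional powers from a vanishing Wronskian -/

section Proportional
variable {k : Type*} [Field k] [CharZero k]

/-- The difference `f - g` also has zero Wronskian with `g` but smaller degree. Comparing top
coefficients, in characteristic zero, forces equal degrees. -/
theorem Polynomial.eq_of_wronskian_eq_zero {f g : k[X]} (hw : f * derivative g = derivative f * g)
    (hg : g ≠ 0) (hdeg : f.natDegree = g.natDegree) (hlc : f.leadingCoeff = g.leadingCoeff) :
    f = g := by
  by_contra hne
  have hh : f - g ≠ 0 := sub_ne_zero.mpr hne
  have hf : f ≠ 0 := by
    rintro rfl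
    rw [leadingCoeff_zero, eq_comm, leadingCoeff_eq_zero] at hlc
    exact hg hlc
  have hlt : (f - g).natDegree < g.natDegree := by
    rw [← hdeg]
    exact natDegree_lt_natDegree hh (degree_sub_lt_left
      (by rw [degree_eq_natDegree hf, degree_eq_natDegree hg, hdeg]) hf hlc)
  have hw' : (f - g) * derivative g = derivative (f - g) * g := by
    rw [derivative_sub]; linear_combination hw
  set h := f - g
  set M := h.natDegree with hM
  obtain ⟨N, hN⟩ : ∃ N, g.natDegree = N + 1 := ⟨g.natDegree - 1, by omega⟩
  have hgd : (derivative g).natDegree ≤ N := (natDegree_derivative_le g).trans (by omega)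
  have hgl : g.coeff (N + 1) ≠ 0 := by
    rw [← hN, coeff_natDegree]; exact leadingCoeff_ne_zero.mpr hg
  have hhl : h.coeff M ≠ 0 := by
    rw [hM, coeff_natDegree]; exact leadingCoeff_ne_zero.mpr hh
  have h1 : (h * derivative g).coeff (M + N) = h.coeff M * (g.coeff (N + 1) * (N + 1)) := by
    rw [coeff_mul_add_eq_of_natDegree_le le_rfl hgd, coeff_derivative]
  rw [hw'] at h1
  rcases Nat.eq_zero_or_pos M with h0 | h0
  · have : derivative h = 0 := by
      rw [eq_C_of_natDegree_eq_zero (hM.symm.trans h0), derivative_C]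
    rw [this, zero_mul, coeff_zero] at h1
    have : (N : k) + 1 ≠ 0 := by exact_mod_cast Nat.succ_ne_zero N
    exact mul_ne_zero hhl (mul_ne_zero hgl this) h1.symm
  · obtain ⟨m, hm⟩ : ∃ m, M = m + 1 := ⟨M - 1, by omega⟩
    have hhd : (derivative h).natDegree ≤ m := (natDegree_derivative_le h).trans (by omega)
    rw [show M + N = m + (N + 1) by omega, coeff_mul_add_eq_of_natDegree_le hhd hN.le, coeff_derivative,
      ← hm] at h1
    have h2 : ((m : k) + 1) = N + 1 := by
      have h3 : h.coeff M * g.coeff (N + 1) ≠ 0 := mul_ne_zero hhl hgl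
      apply mul_left_cancel₀ h3
      linear_combination h1
    have : m = N := by exact_mod_cast add_right_cancel h2
    omega

/-- The hypothesis equates the logarithmic derivatives of `q^d` and `p^e`; degrees and leading
coefficients then fix the constant. -/
theorem Polynomial.C_mul_pow_eq_of_wronskian {p q : k[X]} {d e : ℕ} {α β : k}
    (hp : p ≠ 0) (hq : q ≠ 0) (hα : α ≠ 0) (hβ : β ≠ 0)
    (hw : C (d : k) * p * derivative q = C (e : k) * derivative p * q)
    (hdeg : e * p.natDegree = d * q.natDegree)
    (hlc : α * p.leadingCoeff ^ e = β * q.leadingCoeff ^ d) :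
    C α * p ^ e = C β * q ^ d := by
  refine eq_of_wronskian_eq_zero ?_ (mul_ne_zero (C_ne_zero.mpr hβ) (pow_ne_zero _ hq)) ?_ ?_
  · rw [derivative_C_mul, derivative_C_mul, derivative_pow, derivative_pow]
    rcases e with _ | e
    · rcases d with _ | d
      · simp
      · simp only [Nat.cast_zero, C_0, zero_mul] at hw
        simp only [Nat.cast_zero, C_0, zero_mul, mul_zero]
        have h3 := (mul_eq_zero.mp hw).resolve_left
          (mul_ne_zero (C_ne_zero.mpr (by exact_mod_cast Nat.succ_ne_zero d)) hp)
        rw [h3]; ring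
    · rcases d with _ | d
      · simp only [Nat.cast_zero, C_0, zero_mul] at hw
        have h3 := (mul_eq_zero.mp hw.symm).resolve_right hq
        have h4 := (mul_eq_zero.mp h3).resolve_left
          (C_ne_zero.mpr (by exact_mod_cast Nat.succ_ne_zero e))
        rw [h4]; simp
      · simp only [Nat.add_sub_cancel]
        rw [pow_succ p, pow_succ q]
        linear_combination (C α * C β * p ^ e * q ^ d) * hw
  · rw [natDegree_C_mul hα, natDegree_C_mul hβ, natDegree_pow, natDegree_pow, hdeg]
  · rw [leadingCoeff_mul, leadingCoeff_mul, leadingCoeff_C, leadingCoeff_C, leadingCoeff_pow,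
      leadingCoeff_pow, hlc]

end Proportional

/-! ### Reductions at neighbouring radii -/

section Local
open Filter Topology
variable {k : Type*} [Field k]

theorem GaussLE.unique {F : (HahnSeries ℝ k)[X]} {r w w' : ℝ} (h : GaussLE F r w)
    (h0 : redAt F r w ≠ 0) (h' : GaussLE F r w') (h0' : redAt F r w' ≠ 0) : w = w' := by
  rcases lt_trichotomy w w' with hlt | rfl | hlt
  · exact absurd (h'.redAt_eq_zero hlt) h0
  · rfl
  · exact absurd (h.redAt_eq_zero hlt) h0'

theorem gaussLE_and_redAt_eq_monomial {F : (HahnSeries ℝ k)[X]} {r w : ℝ} {n : ℕ} {c : k}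
    (h : ∀ i : ℕ, VanishesBelow (w - i * r) (F.coeff i) ∧
      (F.coeff i).coeff (w - i * r) = if n = i then c else 0) :
    GaussLE F r w ∧ redAt F r w = monomial n c := by
  refine ⟨fun i => (h i).1, ?_⟩
  ext i
  rw [coeff_redAt, (h i).2, coeff_monomial]

/-- Moving `r` to `r'` changes the weight of a degree-`i` term by `i (r' - r)`, which breaks ties in
favour of degree `n`. Terms strictly above the minimum stay above it nearby. -/
theorem GaussLE.eventually_monomial {F : (HahnSeries ℝ k)[X]} {r w : ℝ} (hF : GaussLE F r w)
    (n : ℕ) {l : Filter ℝ} (hl : l ≤ 𝓝 r)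
    (hn : ∀ i, i ≠ n → (redAt F r w).coeff i ≠ 0 → ∀ᶠ r' in l, ((n : ℝ) - i) * (r' - r) < 0) :
    ∀ᶠ r' in l, GaussLE F r' (w + n * (r' - r)) ∧
      redAt F r' (w + n * (r' - r)) = monomial n ((redAt F r w).coeff n) := by
  have key : ∀ i : ℕ, ∀ᶠ r' in l,
      VanishesBelow (w + n * (r' - r) - i * r') (F.coeff i) ∧
      (F.coeff i).coeff (w + n * (r' - r) - i * r') =
        if n = i then (redAt F r w).coeff n else 0 := by
    intro i
    have hid : ∀ r' : ℝ, w + n * (r' - r) - i * r' = (w - i * r) + (n - i) * (r' - r) := by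
      intro r'; ring
    rcases eq_or_ne i n with rfl | hin
    · refine Eventually.of_forall fun r' => ?_
      rw [hid, sub_self, zero_mul, add_zero, if_pos rfl, coeff_redAt]
      exact ⟨hF i, rfl⟩
    · rw [if_neg hin.symm]
      by_cases hc : (redAt F r w).coeff i = 0
      · by_cases h0 : F.coeff i = 0
        · exact Eventually.of_forall fun r' => by rw [h0]; exact ⟨VanishesBelow.zero, rfl⟩
        · rw [coeff_redAt] at hc
          have hlt : w - i * r < (F.coeff i).order := by
            refine lt_of_le_of_ne ((hF i).le_order h0) fun h => ?_
            rw [h, HahnSeries.coeff_order_eq_zero] at hc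
            exact h0 hc
          have ht : Tendsto (fun r' : ℝ => (w - i * r) + (n - i) * (r' - r)) l
              (𝓝 (w - i * r)) := by
            have : Tendsto (fun r' : ℝ => (w - i * r) + (n - i) * (r' - r)) (𝓝 r)
              (𝓝 ((w - i * r) + (n - i) * (r - r))) := Continuous.tendsto (by fun_prop) r
            rw [sub_self, mul_zero, add_zero] at this
            exact this.mono_left hl
          filter_upwards [ht.eventually (gt_mem_nhds hlt)] with r' hr'
          rw [hid]
          exact ⟨VanishesBelow.order.mono hr'.le, VanishesBelow.order _ hr'⟩
      · filter_upwards [hn i hin hc] with r' hr'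
        rw [hid]
        exact ⟨(hF i).mono (by linarith), hF i _ (by linarith)⟩
  -- Only finitely many `i` matter. The range extends past `n` because `n` need not be bounded by
  -- the degree of `F`.
  have hfin : ∀ᶠ r' in l, ∀ i ∈ Finset.range (F.natDegree + 1 + n + 1),
      VanishesBelow (w + n * (r' - r) - i * r') (F.coeff i) ∧
      (F.coeff i).coeff (w + n * (r' - r) - i * r') =
        if n = i then (redAt F r w).coeff n else 0 :=
    (eventually_all_finset _).mpr fun i _ => key i
  filter_upwards [hfin] with r' hr'
  refine gaussLE_and_redAt_eq_monomial fun (i : ℕ) => ?_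
  by_cases hi : i ∈ Finset.range (F.natDegree + 1 + n + 1)
  · exact hr' i hi
  · rw [Finset.mem_range, not_lt] at hi
    rw [coeff_eq_zero_of_natDegree_lt (by omega), if_neg (by omega)]
    exact ⟨VanishesBelow.zero, rfl⟩

/-- A smaller order of `T` favours the highest power, a larger one the lowest. -/
theorem GaussLE.eventually_left {F : (HahnSeries ℝ k)[X]} {r w : ℝ} (hF : GaussLE F r w) :
    ∀ᶠ r' in 𝓝[<] r, GaussLE F r' (w + (redAt F r w).natDegree * (r' - r)) ∧
      redAt F r' (w + (redAt F r w).natDegree * (r' - r)) =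
        monomial (redAt F r w).natDegree (redAt F r w).leadingCoeff := by
  refine hF.eventually_monomial _ nhdsWithin_le_nhds fun i hi hc => ?_
  have hlt : (i : ℝ) < (redAt F r w).natDegree := by
    exact_mod_cast lt_of_le_of_ne (le_natDegree_of_ne_zero hc) hi
  filter_upwards [self_mem_nhdsWithin] with r' hr'
  have : r' < r := hr'
  exact mul_neg_of_pos_of_neg (by linarith) (by linarith)

theorem GaussLE.eventually_right {F : (HahnSeries ℝ k)[X]} {r w : ℝ} (hF : GaussLE F r w) :
    ∀ᶠ r' in 𝓝[>] r, GaussLE F r' (w + (redAt F r w).natTrailingDegree * (r' - r)) ∧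
      redAt F r' (w + (redAt F r w).natTrailingDegree * (r' - r)) =
        monomial (redAt F r w).natTrailingDegree (redAt F r w).trailingCoeff := by
  refine hF.eventually_monomial _ nhdsWithin_le_nhds fun i hi hc => ?_
  have hlt : ((redAt F r w).natTrailingDegree : ℝ) < i := by
    exact_mod_cast lt_of_le_of_ne (natTrailingDegree_le_of_ne_zero hc) hi.symm
  filter_upwards [self_mem_nhdsWithin] with r' hr'
  have : r < r' := hr'
  exact mul_neg_of_neg_of_pos (by linarith) (by linarith)

theorem eventually_atBot_gaussLE {F : (HahnSeries ℝ k)[X]} {A : k}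
    (hA : F.leadingCoeff = HahnSeries.single 0 A) :
    ∀ᶠ r in atBot, GaussLE F r (F.natDegree * r) ∧
      redAt F r (F.natDegree * r) = monomial F.natDegree A := by
  have key : ∀ i ∈ Finset.range F.natDegree, ∀ᶠ r in atBot, r < 0 ∧ r < (F.coeff i).order :=
    fun i _ => (eventually_lt_atBot 0).and (eventually_lt_atBot _)
  filter_upwards [(eventually_all_finset _).mpr key] with r hr
  refine gaussLE_and_redAt_eq_monomial fun (i : ℕ) => ?_
  rcases lt_trichotomy i F.natDegree with hi | hi | hi
  · rw [if_neg hi.ne']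
    obtain ⟨h0, h1⟩ := hr i (Finset.mem_range.mpr hi)
    have h2 : (i : ℝ) + 1 ≤ F.natDegree := by exact_mod_cast hi
    have h3 : F.natDegree * r - i * r < (F.coeff i).order := by nlinarith
    exact ⟨VanishesBelow.order.mono h3.le, VanishesBelow.order _ h3⟩
  · rw [hi, coeff_natDegree, hA, sub_self, if_pos rfl]
    exact ⟨VanishesBelow.single _ _, HahnSeries.coeff_single_same _ _⟩
  · rw [coeff_eq_zero_of_natDegree_lt hi, if_neg hi.ne]
    exact ⟨VanishesBelow.zero, rfl⟩

end Local

theorem Polynomial.trailingCoeff_C' {R : Type*} [Semiring R] (a : R) :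
    (C a).trailingCoeff = a := by
  simp [trailingCoeff]

theorem Polynomial.trailingCoeff_pow' {R : Type*} [CommRing R] [IsDomain R] (p : R[X]) (n : ℕ) :
    (p ^ n).trailingCoeff = p.trailingCoeff ^ n := by
  induction n with
  | zero => rw [pow_zero, pow_zero, ← C_1, trailingCoeff_C']
  | succ n ih => rw [pow_succ, pow_succ, trailingCoeff_mul, ih]

theorem Polynomial.natTrailingDegree_pow' {R : Type*} [CommRing R] [IsDomain R] {p : R[X]}
    (hp : p ≠ 0) (n : ℕ) : (p ^ n).natTrailingDegree = n * p.natTrailingDegree := by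
  induction n with
  | zero => simp
  | succ n ih => rw [pow_succ, natTrailingDegree_mul (pow_ne_zero _ hp) hp, ih]; ring

/-! ### Propagating the alignment of top terms along increasing radii -/

section Chain
open Filter Topology
variable {k : Type*} [Field k]

/-- On the disc of order `r`, the top terms of `F` and `G` satisfy the same relation as those of
`A T^d` and `B T^e`, up to a common power. -/
def AlignedAt (d e : ℕ) (A B : k) (F G : (HahnSeries ℝ k)[X]) (r : ℝ) : Prop :=
  ∃ a b : ℝ, GaussLE F r a ∧ redAt F r a ≠ 0 ∧ GaussLE G r b ∧ redAt G r b ≠ 0 ∧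
    e * a = d * b ∧ e * (redAt F r a).natDegree = d * (redAt G r b).natDegree ∧
    B ^ d * (redAt F r a).leadingCoeff ^ e = A ^ e * (redAt G r b).leadingCoeff ^ d

variable {d e : ℕ} {A B : k} {F G : (HahnSeries ℝ k)[X]}

theorem exists_alignedAt_lt {K : ℕ} (hA : A ≠ 0) (hB : B ≠ 0) (hF : F.natDegree = K * d)
    (hG : G.natDegree = K * e) (hFA : F.leadingCoeff = HahnSeries.single 0 A)
    (hGB : G.leadingCoeff = HahnSeries.single 0 B) (q : ℝ) :
    ∃ r < q, AlignedAt d e A B F G r := by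
  obtain ⟨r, ⟨⟨h1, h2⟩, h3, h4⟩, hr⟩ := (((eventually_atBot_gaussLE hFA).and
    (eventually_atBot_gaussLE hGB)).and (eventually_lt_atBot q)).exists
  refine ⟨r, hr, _, _, h1, ?_, h3, ?_, ?_, ?_, ?_⟩
  · rw [h2]; simpa using hA
  · rw [h4]; simpa using hB
  · rw [hF, hG]; push_cast; ring
  · rw [h2, h4, natDegree_monomial_eq _ hA, natDegree_monomial_eq _ hB, hF, hG]; ring
  · rw [h2, h4, leadingCoeff_monomial, leadingCoeff_monomial]; ring

/-- Just left of `r` the reductions are the leading monomials of those at `r`, so degrees and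
leading coefficients agree. The weights are corrected linearly in `r' - r`. -/
theorem AlignedAt.of_left {r : ℝ} (hF : F ≠ 0) (hG : G ≠ 0)
    (h : ∃ᶠ r' in 𝓝[<] r, AlignedAt d e A B F G r') : AlignedAt d e A B F G r := by
  obtain ⟨a, hFa, hFa0⟩ := exists_gaussLE_redAt_ne_zero hF r
  obtain ⟨b, hGb, hGb0⟩ := exists_gaussLE_redAt_ne_zero hG r
  obtain ⟨r', ⟨a', b', ha, ha0, hb, hb0, hab, hdeg, hlc⟩, ⟨h1, h2⟩, h3, h4⟩ :=
    (h.and_eventually (hFa.eventually_left.and hGb.eventually_left)).exists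
  have hl1 : (redAt F r a).leadingCoeff ≠ 0 := leadingCoeff_ne_zero.mpr hFa0
  have hl2 : (redAt G r b).leadingCoeff ≠ 0 := leadingCoeff_ne_zero.mpr hGb0
  obtain rfl := ha.unique ha0 h1 (by rw [h2]; simpa using hFa0)
  obtain rfl := hb.unique hb0 h3 (by rw [h4]; simpa using hGb0)
  rw [h2, h4, natDegree_monomial_eq _ hl1, natDegree_monomial_eq _ hl2] at hdeg
  rw [h2, h4, leadingCoeff_monomial, leadingCoeff_monomial] at hlc
  refine ⟨a, b, hFa, hFa0, hGb, hGb0, ?_, hdeg, hlc⟩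
  have hdeg' : (e : ℝ) * (redAt F r a).natDegree = d * (redAt G r b).natDegree := by
    exact_mod_cast hdeg
  linear_combination hab - (r' - r) * hdeg'

/-- Proportional powers have proportional trailing terms too, and just right of `r` the trailing
terms are all that remains. -/
theorem AlignedAt.eventually_right {r a b : ℝ} (hA : A ≠ 0) (hB : B ≠ 0)
    (hFa : GaussLE F r a) (hFa0 : redAt F r a ≠ 0)
    (hGb : GaussLE G r b) (hGb0 : redAt G r b ≠ 0) (hab : e * a = d * b)
    (h : C (B ^ d) * redAt F r a ^ e = C (A ^ e) * redAt G r b ^ d) :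
    ∀ᶠ r' in 𝓝[>] r, AlignedAt d e A B F G r' := by
  have hl1 : (redAt F r a).trailingCoeff ≠ 0 := by rwa [Ne, trailingCoeff_eq_zero]
  have hl2 : (redAt G r b).trailingCoeff ≠ 0 := by rwa [Ne, trailingCoeff_eq_zero]
  have hd : e * (redAt F r a).natTrailingDegree = d * (redAt G r b).natTrailingDegree := by
    have := congrArg natTrailingDegree h
    rwa [natTrailingDegree_mul (by simpa using fun h => absurd h hB) (pow_ne_zero _ hFa0),
      natTrailingDegree_mul (by simpa using fun h => absurd h hA) (pow_ne_zero _ hGb0),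
      natTrailingDegree_C, natTrailingDegree_C, natTrailingDegree_pow' hFa0, natTrailingDegree_pow' hGb0,
      zero_add, zero_add] at this
  have hc : B ^ d * (redAt F r a).trailingCoeff ^ e = A ^ e * (redAt G r b).trailingCoeff ^ d := by
    have := congrArg trailingCoeff h
    rwa [trailingCoeff_mul, trailingCoeff_mul, trailingCoeff_pow', trailingCoeff_pow',
      trailingCoeff_C', trailingCoeff_C'] at this
  filter_upwards [hFa.eventually_right, hGb.eventually_right] with r' ⟨h1, h2⟩ ⟨h3, h4⟩
  refine ⟨_, _, h1, ?_, h3, ?_, ?_, ?_, ?_⟩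
  · rw [h2]; simpa using hl1
  · rw [h4]; simpa using hl2
  · have hd' : (e : ℝ) * (redAt F r a).natTrailingDegree = d * (redAt G r b).natTrailingDegree := by
      exact_mod_cast hd
    linear_combination hab + (r' - r) * hd'
  · rw [h2, h4, natDegree_monomial_eq _ hl1, natDegree_monomial_eq _ hl2, hd]
  · rw [h2, h4, leadingCoeff_monomial, leadingCoeff_monomial, hc]

theorem GaussLE.natDegree_redAt_eq_zero_of_lt {r a q : ℝ} (hF : GaussLE F r a) (ha : 0 ≤ a)
    (hr : r < q) : (redAt F q 0).natDegree = 0 := by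
  rw [← Nat.le_zero, natDegree_le_iff_coeff_eq_zero]
  intro i hi
  have hi' : (0 : ℝ) < i := by exact_mod_cast hi
  rw [coeff_redAt]
  exact hF i _ (by nlinarith)

/-- If the weighted Wronskian of all reductions is constant, the top terms stay aligned down to
the disc where `F` and `G` become finite. -/
theorem alignedAt_of_wronskian [CharZero k] [Algebra ℝ k] {K : ℕ} (hd : d ≠ 0) (he : e ≠ 0)
    (hA : A ≠ 0) (hB : B ≠ 0) (hF : F.natDegree = K * d)
    (hG : G.natDegree = K * e) (hFA : F.leadingCoeff = HahnSeries.single 0 A)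
    (hGB : G.leadingCoeff = HahnSeries.single 0 B)
    (hW : ∀ r a b, GaussLE F r a → GaussLE G r b → ∃ c : k,
      C (algebraMap ℝ k a) * redAt F r a * derivative (redAt G r b) -
        C (algebraMap ℝ k b) * derivative (redAt F r a) * redAt G r b = C c)
    {q : ℝ} (hFq : GaussLE F q 0) (hGq : GaussLE G q 0)
    (hnc : ¬ ((redAt F q 0).natDegree = 0 ∧ (redAt G q 0).natDegree = 0)) :
    AlignedAt d e A B F G q := by
  have hF0 : F ≠ 0 := by
    rintro rfl; rw [leadingCoeff_zero, eq_comm, HahnSeries.single_eq_zero_iff] at hFA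
    exact hA hFA
  have hG0 : G ≠ 0 := by
    rintro rfl; rw [leadingCoeff_zero, eq_comm, HahnSeries.single_eq_zero_iff] at hGB
    exact hB hGB
  obtain ⟨r₀, hr₀, hal₀⟩ := exists_alignedAt_lt hA hB hF hG hFA hGB q
  set S := {r | r ≤ q ∧ AlignedAt d e A B F G r} with hS
  have hSne : S.Nonempty := ⟨r₀, hr₀.le, hal₀⟩
  have hSb : BddAbove S := ⟨q, fun r hr => hr.1⟩
  set R := sSup S with hR
  have hRq : R ≤ q := csSup_le hSne fun r hr => hr.1
  -- The supremum belongs to the set; otherwise aligned radii accumulate at it from the left, which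
  -- already gives alignment there.
  have hal : AlignedAt d e A B F G R := by
    by_contra hna
    refine hna (AlignedAt.of_left hF0 hG0 ?_)
    rw [frequently_iff]
    intro U hU
    obtain ⟨l, hl, hlU⟩ := mem_nhdsLT_iff_exists_Ioo_subset.mp hU
    obtain ⟨s, hs, hls⟩ := exists_lt_of_lt_csSup hSne hl
    have hsR : s < R := lt_of_le_of_ne (le_csSup hSb hs) (by rintro rfl; exact hna hs.2)
    exact ⟨s, hlU ⟨hls, hsR⟩, hs.2⟩
  rcases hRq.eq_or_lt with h | hlt
  · rwa [h] at hal
  exfalso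
  obtain ⟨a, b, hFa, hFa0, hGb, hGb0, hab, hdeg, hlc⟩ := hal
  have hd' : (0 : ℝ) < d := by exact_mod_cast Nat.pos_of_ne_zero hd
  have he' : (0 : ℝ) < e := by exact_mod_cast Nat.pos_of_ne_zero he
  -- Proportionality at `R < q` would extend alignment past the supremum.
  have hnp : C (B ^ d) * redAt F R a ^ e ≠ C (A ^ e) * redAt G R b ^ d := by
    intro h
    obtain ⟨s, ⟨hs, hsR⟩, hsq⟩ := (((AlignedAt.eventually_right hA hB hFa hFa0 hGb hGb0 hab h).and
      self_mem_nhdsWithin).and (mem_nhdsWithin_of_mem_nhds (Iio_mem_nhds hlt))).exists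
    exact absurd (le_csSup hSb ⟨le_of_lt hsq, hs⟩) (not_le.mpr hsR)
  -- With nonnegative weights at `R < q`, the weight-zero parts at `q` would be constant. With
  -- negative weights the Wronskian vanishes.
  rcases le_or_gt 0 a with ha | ha
  · have hb : 0 ≤ b := by
      by_contra! hb
      nlinarith [mul_nonneg he'.le ha, mul_neg_of_pos_of_neg hd' hb]
    exact hnc ⟨hFa.natDegree_redAt_eq_zero_of_lt ha hlt, hGb.natDegree_redAt_eq_zero_of_lt hb hlt⟩
  · have hb : b < 0 := by
      by_contra! hb
      nlinarith [mul_nonneg hd'.le hb, mul_neg_of_pos_of_neg he' ha]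
    -- The constant term in `T` has no negative exponents, as seen at radius `q`, so it does not
    -- contribute at weight `a < 0`.
    have hz : ∀ {F : (HahnSeries ℝ k)[X]} {a : ℝ}, GaussLE F q 0 → a < 0 →
        (redAt F R a).eval 0 = 0 := by
      intro F a hF ha
      rw [← coeff_zero_eq_eval_zero, coeff_redAt]
      exact hF 0 _ (by simpa using ha)
    obtain ⟨c, hc⟩ := hW R a b hFa hGb
    have hc0 : c = 0 := by
      have := congrArg (eval 0) hc
      simp only [eval_sub, eval_mul, eval_C, hz hFq ha, hz hGq hb, mul_zero, zero_mul,
        sub_zero] at this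
      exact this.symm
    rw [hc0, C_0, sub_eq_zero] at hc
    refine hnp (C_mul_pow_eq_of_wronskian hFa0 hGb0 (pow_ne_zero _ hB) (pow_ne_zero _ hA)
      ?_ hdeg hlc)
    -- Since `e a = d b` with `b ≠ 0`, the weights `a`, `b` in the Wronskian can be traded for `d`,
    -- `e`.
    have hab' : (e : k) * algebraMap ℝ k a = d * algebraMap ℝ k b := by
      have := congrArg (algebraMap ℝ k) hab
      simpa using this
    have hbk : algebraMap ℝ k b ≠ 0 := by simpa using hb.ne
    apply mul_left_cancel₀ (C_ne_zero.mpr hbk)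
    have hab'' : C (e : k) * C (algebraMap ℝ k a) = C (d : k) * C (algebraMap ℝ k b) := by
      rw [← C_mul, ← C_mul, hab']
    linear_combination C (e : k) * hc -
      redAt F R a * derivative (redAt G R b) * hab''

end Chain

/-! ### Extension of the coefficient field -/

section BaseChange
variable {R S : Type*} [CommRing R] [CommRing S]

/-- Apply a ring homomorphism to the coefficients of a generalized power series. -/
noncomputable def hahnMap (f : R →+* S) : HahnSeries ℝ R →+* HahnSeries ℝ S where
  toFun x := x.map f
  map_one' := by
    ext s
    simp only [HahnSeries.map_coeff, HahnSeries.coeff_one]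
    split_ifs <;> simp
  map_mul' _ _ := HahnSeries.map_mul (f : R →ₙ+* S)
  map_zero' := HahnSeries.map_zero (f : ZeroHom R S)
  map_add' x y := by ext; simp

@[simp]
theorem coeff_hahnMap (f : R →+* S) (x : HahnSeries ℝ R) (s : ℝ) :
    (hahnMap f x).coeff s = f (x.coeff s) := rfl

theorem hahnMap_single (f : R →+* S) (a : ℝ) (c : R) :
    hahnMap f (HahnSeries.single a c) = HahnSeries.single a (f c) := by
  ext s
  rw [coeff_hahnMap, HahnSeries.coeff_single, HahnSeries.coeff_single]
  split_ifs <;> simp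

theorem VanishesBelow.hahnMap {a : ℝ} {x : HahnSeries ℝ R} (h : VanishesBelow a x) (f : R →+* S) :
    VanishesBelow a (hahnMap f x) := fun s hs => by rw [coeff_hahnMap, h s hs, map_zero]

theorem GaussLE.map {F : (HahnSeries ℝ R)[X]} {r w : ℝ} (hF : GaussLE F r w) (f : R →+* S) :
    GaussLE (F.map (hahnMap f)) r w := fun i => by
  rw [coeff_map]; exact (hF i).hahnMap f

theorem redAt_map (F : (HahnSeries ℝ R)[X]) (r w : ℝ) (f : R →+* S) :
    redAt (F.map (hahnMap f)) r w = (redAt F r w).map f := by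
  ext i
  simp

theorem exists_hahnMap_eq {f : R →+* S} (hf : Function.Injective f) {y : HahnSeries ℝ S}
    (hy : ∀ s, y.coeff s ∈ f.range) : ∃ x, hahnMap f x = y := by
  choose c hc using hy
  refine ⟨⟨c, y.isPWO_support.mono fun s hs => ?_⟩, ?_⟩
  · intro h0
    rw [← hc, map_eq_zero_iff f hf] at h0
    exact hs h0
  · ext s
    exact hc s

end BaseChange

/-! ### From a branch with generic limit to a polynomial curve -/

section Dicritical
variable {k κ : Type*} [Field k] [Field κ]

/-- The bivariate polynomial `P` as a polynomial in its second variable. -/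
noncomputable def polyInY (k : Type*) [CommRing k] : MvPolynomial (Fin 2) k →+* k[X][X] :=
  MvPolynomial.eval₂Hom (C.comp C) ![C X, X]

/-- Evaluation of `k[x]` at `x = 1/t`. -/
noncomputable def evalInvT (k : Type*) [CommRing k] : k[X] →+* HahnSeries ℝ k :=
  eval₂RingHom HahnSeries.C (HahnSeries.single (-1) 1)

/-- Evaluation of a bivariate polynomial at `x = 1/t` and a generalized power series `y`. -/
noncomputable def evalPuiseux {k κ : Type*} [CommRing k] [CommRing κ] (f : k →+* κ)
    (y : HahnSeries ℝ κ) :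
    MvPolynomial (Fin 2) k →+* HahnSeries ℝ κ :=
  MvPolynomial.eval₂Hom (HahnSeries.C.comp f) ![HahnSeries.single (-1) 1, y]

theorem puiseuxSubst_eq_taylor (φ : HahnSeries ℝ k) (P : MvPolynomial (Fin 2) k) :
    puiseuxSubst φ P = taylor φ ((polyInY k P).map (evalInvT k)) := by
  induction P using MvPolynomial.induction_on with
  | C a => simp [puiseuxSubst_C, polyInY, evalInvT, HahnSeries.C_apply]
  | add p q hp hq => simp only [map_add, hp, hq, Polynomial.map_add]
  | mul_X p i hp =>
    rw [map_mul, map_mul, Polynomial.map_mul, taylor_mul, hp]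
    congr 1
    fin_cases i
    · simp [puiseuxSubst_X_zero, polyInY, evalInvT]
    · simp [puiseuxSubst_X_one, polyInY, add_comm]

theorem eval_map_puiseuxSubst {f : k →+* κ} (φ : HahnSeries ℝ k) (δ : HahnSeries ℝ κ)
    (P : MvPolynomial (Fin 2) k) :
    ((puiseuxSubst φ P).map (hahnMap f)).eval δ = evalPuiseux f (δ + hahnMap f φ) P := by
  induction P using MvPolynomial.induction_on with
  | C a => simp [puiseuxSubst_C, evalPuiseux, hahnMap_single, HahnSeries.C_apply]
  | add p q hp hq => simp only [map_add, hp, hq, Polynomial.map_add, eval_add]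
  | mul_X p i hp =>
    rw [map_mul, map_mul, Polynomial.map_mul, eval_mul, hp]
    congr 1
    fin_cases i
    · simp [puiseuxSubst_X_zero, evalPuiseux, hahnMap_single]
    · simp [puiseuxSubst_X_one, evalPuiseux, add_comm]

theorem natDegree_puiseuxSubst {P : MvPolynomial (Fin 2) k} {A : k} (hA : A ≠ 0)
    (hPA : (polyInY k P).leadingCoeff = C A) (φ : HahnSeries ℝ k) :
    (puiseuxSubst φ P).natDegree = (polyInY k P).natDegree ∧
      (puiseuxSubst φ P).leadingCoeff = HahnSeries.single 0 A := by
  have h1 : evalInvT k (polyInY k P).leadingCoeff = HahnSeries.single 0 A := by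
    rw [hPA]; simp [evalInvT, HahnSeries.C_apply]
  have h2 : evalInvT k (polyInY k P).leadingCoeff ≠ 0 := by
    rw [h1]; exact HahnSeries.single_ne_zero hA
  rw [puiseuxSubst_eq_taylor, natDegree_taylor, natDegree_map_of_leadingCoeff_ne_zero _ h2]
  refine ⟨rfl, ?_⟩
  rw [leadingCoeff_taylor, leadingCoeff_map_of_leadingCoeff_ne_zero _ h2, h1]

variable [Algebra k κ]

theorem aeval_ne_zero_of_notMem_range [IsAlgClosed k] {ξ : κ} (hξ : ξ ∉ (algebraMap k κ).range)
    {p : k[X]} (hp : p ≠ 0) : p.aeval ξ ≠ 0 := by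
  intro h
  have hint : IsIntegral k ξ := (show IsAlgebraic k ξ from ⟨p, hp, h⟩).isIntegral
  exact hξ (minpoly.mem_range_of_degree_eq_one k ξ
    (IsAlgClosed.degree_eq_one_of_irreducible k (minpoly.irreducible hint)))

/-- Non-constant finite values along a branch at infinity lie on a polynomial curve, whose leading
terms are aligned with those of `P` and `Q`. -/
theorem exists_polynomial_curve [IsAlgClosed k] [CharZero k] [Algebra ℝ k]
    {P Q : MvPolynomial (Fin 2) k} {K d e : ℕ} {A B : k}
    (hJ : ∃ c : k, MvPolynomial.pderiv 0 P * MvPolynomial.pderiv 1 Q -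
      MvPolynomial.pderiv 1 P * MvPolynomial.pderiv 0 Q = MvPolynomial.C c)
    (hd : d ≠ 0) (he : e ≠ 0) (hde : d.Coprime e) (hA : A ≠ 0) (hB : B ≠ 0)
    (hPy : (polyInY k P).natDegree = K * d) (hPA : (polyInY k P).leadingCoeff = C A)
    (hQy : (polyInY k Q).natDegree = K * e) (hQB : (polyInY k Q).leadingCoeff = C B)
    {y : HahnSeries ℝ κ} (hP : VanishesBelow 0 (evalPuiseux (algebraMap k κ) y P))
    (hQ : VanishesBelow 0 (evalPuiseux (algebraMap k κ) y Q))
    (hnc : ¬ ((evalPuiseux (algebraMap k κ) y P).coeff 0 ∈ (algebraMap k κ).range ∧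
      (evalPuiseux (algebraMap k κ) y Q).coeff 0 ∈ (algebraMap k κ).range)) :
    ∃ (ξ : κ) (p q : k[X]) (j : ℕ), j ≠ 0 ∧ p.natDegree = d * j ∧ q.natDegree = e * j ∧
      B ^ d * p.leadingCoeff ^ e = A ^ e * q.leadingCoeff ^ d ∧
      p.aeval ξ = (evalPuiseux (algebraMap k κ) y P).coeff 0 ∧
      q.aeval ξ = (evalPuiseux (algebraMap k κ) y Q).coeff 0 := by
  set f := algebraMap k κ with hf
  have hinj : Function.Injective f := f.injective
  -- If every coefficient of `y` lay in `k`, so would both limits.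
  set T := {s | y.coeff s ∉ f.range} with hT
  have hTsupp : T ⊆ y.support := fun s hs h0 => hs (by rw [h0]; exact zero_mem _)
  have hTne : T.Nonempty := by
    by_contra hTe
    rw [Set.not_nonempty_iff_eq_empty] at hTe
    obtain ⟨φ, rfl⟩ := exists_hahnMap_eq hinj (y := y) fun s => by
      by_contra hs
      have : s ∈ T := hs
      rw [hTe] at this
      exact this
    have h : ∀ P, (evalPuiseux f (hahnMap f φ) P).coeff 0 ∈ f.range := by
      intro P
      have := eval_map_puiseuxSubst (f := f) φ 0 P
      rw [zero_add] at this
      rw [← this, eval_map, eval₂_at_zero, coeff_hahnMap]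
      exact ⟨_, rfl⟩
    exact hnc ⟨h P, h Q⟩
  have hWF : T.IsWF := y.isWF_support.mono hTsupp
  set q₀ := hWF.min hTne with hq₀
  have hq₀T : y.coeff q₀ ∉ f.range := hWF.min_mem hTne
  obtain ⟨φ, hφ⟩ := exists_hahnMap_eq hinj (y := HahnSeries.truncLT q₀ y) fun s => by
    rw [HahnSeries.coeff_truncLT]
    split_ifs with h
    · by_contra hs
      exact hWF.not_lt_min hTne hs h
    · exact zero_mem _
  set δ := y - hahnMap f φ with hδ
  have hyδ : δ + hahnMap f φ = y := sub_add_cancel _ _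
  have hδv : VanishesBelow q₀ δ := fun s hs => by
    rw [hδ, hφ, HahnSeries.coeff_sub, HahnSeries.coeff_truncLT_of_lt hs, sub_self]
  have hδc : δ.coeff q₀ = y.coeff q₀ := by
    rw [hδ, hφ, HahnSeries.coeff_sub, HahnSeries.coeff_truncLT_of_le le_rfl, sub_zero]
  set ξ := y.coeff q₀ with hξ
  have hcoeff : ∀ P w, GaussLE (puiseuxSubst φ P) q₀ w →
      (evalPuiseux f y P).coeff w = (redAt (puiseuxSubst φ P) q₀ w).aeval ξ := by
    intro P w hw
    rw [← hyδ, ← eval_map_puiseuxSubst, (hw.map f).coeff_eval hδv, redAt_map, hδc, eval_map, hf,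
      aeval_def]
  -- As `ξ` is transcendental over `k`, it is no root of a nonzero reduction; so the order along `y`
  -- is the Gauss weight itself.
  have hord : ∀ P w, VanishesBelow 0 (evalPuiseux f y P) → GaussLE (puiseuxSubst φ P) q₀ w →
      redAt (puiseuxSubst φ P) q₀ w ≠ 0 → 0 ≤ w := by
    intro P w hP hw h0
    by_contra! hlt
    have h1 := hcoeff P w hw
    rw [hP w hlt] at h1
    exact aeval_ne_zero_of_notMem_range hq₀T h0 h1.symm
  obtain ⟨hF, hFA⟩ := natDegree_puiseuxSubst hA hPA φ
  obtain ⟨hG, hGB⟩ := natDegree_puiseuxSubst hB hQB φ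
  rw [hPy] at hF
  rw [hQy] at hG
  have hgauss : ∀ (P : MvPolynomial (Fin 2) k) (A : k), A ≠ 0 →
      (puiseuxSubst φ P).leadingCoeff = HahnSeries.single 0 A →
      VanishesBelow 0 (evalPuiseux f y P) → GaussLE (puiseuxSubst φ P) q₀ 0 := by
    intro P A hA hl hP
    have hne : puiseuxSubst φ P ≠ 0 := by
      rw [← leadingCoeff_ne_zero, hl]; exact HahnSeries.single_ne_zero hA
    obtain ⟨w, hw, h0⟩ := exists_gaussLE_redAt_ne_zero hne q₀
    exact hw.mono (hord P w hP hw h0)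
  have hFq := hgauss P A hA hFA hP
  have hGq := hgauss Q B hB hGB hQ
  have hnc' : ¬ ((redAt (puiseuxSubst φ P) q₀ 0).natDegree = 0 ∧
      (redAt (puiseuxSubst φ Q) q₀ 0).natDegree = 0) := by
    rintro ⟨h1, h2⟩
    refine hnc ⟨?_, ?_⟩
    · rw [hcoeff P 0 hFq, eq_C_of_natDegree_eq_zero h1, aeval_C]; exact ⟨_, rfl⟩
    · rw [hcoeff Q 0 hGq, eq_C_of_natDegree_eq_zero h2, aeval_C]; exact ⟨_, rfl⟩
  obtain ⟨a, b, hFa, hFa0, hGb, hGb0, hab, hdeg, hlc⟩ := alignedAt_of_wronskian hd he hA hB hF hG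
    hFA hGB (fun r a b hFa hGb => wronskian_redAt_eq_C φ hJ hFa hGb) hFq hGq hnc'
  have ha := hord P a hP hFa hFa0
  have hb := hord Q b hQ hGb hGb0
  have hd' : (0 : ℝ) < d := by exact_mod_cast Nat.pos_of_ne_zero hd
  have he' : (0 : ℝ) < e := by exact_mod_cast Nat.pos_of_ne_zero he
  -- A positive weight on one side makes both positive, and then both weight-zero parts vanish.
  have ha0 : a = 0 := by
    by_contra hne
    have ha' : 0 < a := lt_of_le_of_ne ha (Ne.symm hne)
    have hb' : 0 < b := by
      have : (0 : ℝ) < d * b := hab ▸ mul_pos he' ha'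
      exact pos_of_mul_pos_right this hd'.le
    exact hnc' ⟨by rw [hFa.redAt_eq_zero ha', natDegree_zero],
      by rw [hGb.redAt_eq_zero hb', natDegree_zero]⟩
  have hb0 : b = 0 := by
    rw [ha0, mul_zero, eq_comm, mul_eq_zero] at hab
    exact hab.resolve_left hd'.ne'
  subst ha0 hb0
  -- Coprimality turns `e deg p = d deg q` into a common factor `j`.
  obtain ⟨j, hj⟩ : d ∣ (redAt (puiseuxSubst φ P) q₀ 0).natDegree :=
    hde.dvd_of_dvd_mul_left ⟨_, hdeg⟩
  have hj' : (redAt (puiseuxSubst φ Q) q₀ 0).natDegree = e * j := by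
    rw [hj] at hdeg
    apply Nat.eq_of_mul_eq_mul_left (Nat.pos_of_ne_zero hd)
    rw [← hdeg]; ring
  refine ⟨ξ, _, _, j, ?_, hj, hj', hlc, (hcoeff P 0 hFq).symm, (hcoeff Q 0 hGq).symm⟩
  rintro rfl
  exact hnc' ⟨hj, hj'⟩

end Dicritical

/-! ### Zeros of the leading coefficient and branches at infinity -/

section Branch

theorem HahnSeries.orderTop_prod_le {R ι : Type*} [CommRing R] [IsDomain R]
    {g h : ι → HahnSeries ℝ R} {s : Multiset ι}
    (H : ∀ y ∈ s, (g y).orderTop ≤ (h y).orderTop) :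
    (s.map g).prod.orderTop ≤ (s.map h).prod.orderTop := by
  induction s using Multiset.induction_on with
  | empty => simp
  | cons a s ih =>
    rw [Multiset.map_cons, Multiset.map_cons, Multiset.prod_cons, Multiset.prod_cons,
      HahnSeries.orderTop_mul, HahnSeries.orderTop_mul]
    exact add_le_add (H a (Multiset.mem_cons_self a s))
      (ih fun y hy => H y (Multiset.mem_cons_of_mem hy))

variable {κ : Type*} [Field κ]

theorem HahnSeries.lt_orderTop_of_forall {x : HahnSeries ℝ κ} {s : ℝ}
    (h : ∀ t ≤ s, x.coeff t = 0) : (s : WithTop ℝ) < x.orderTop := by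
  by_contra! hle
  have hx : x ≠ 0 := by rintro rfl; simp at hle
  rw [← HahnSeries.order_eq_orderTop_of_ne_zero hx, WithTop.coe_le_coe] at hle
  exact HahnSeries.coeff_order_eq_zero.not.mpr hx (h _ hle)

/-- If a resultant `Res(F, G - v)` has larger order than `Res(F, G - v₀)`, then `G` takes a value
congruent to `v` at a root of `F`. -/
theorem exists_root_of_resultant_order [IsAlgClosed κ] {F G : (HahnSeries ℝ κ)[X]} {n : ℕ}
    (hG : G.natDegree ≤ n) {v v₀ : κ} {s : ℝ}
    (h₀ : (resultant F (G - C (HahnSeries.C v₀)) F.natDegree n).coeff s ≠ 0)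
    (h : ∀ t ≤ s, (resultant F (G - C (HahnSeries.C v)) F.natDegree n).coeff t = 0) :
    ∃ y, F.eval y = 0 ∧ VanishesBelow 0 (G.eval y) ∧ (G.eval y).coeff 0 = v := by
  have := HahnSeries.isAlgClosed_real κ
  have hres : ∀ v : κ, resultant F (G - C (HahnSeries.C v)) F.natDegree n =
      F.leadingCoeff ^ n * (F.roots.map fun y => (G.eval y - HahnSeries.C v)).prod := by
    intro v
    rw [resultant_eq_prod_eval _ _ _ ((natDegree_sub_C).trans_le hG) (IsAlgClosed.splits F)]
    simp
  have hlt : (resultant F (G - C (HahnSeries.C v₀)) F.natDegree n).orderTop <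
      (resultant F (G - C (HahnSeries.C v)) F.natDegree n).orderTop :=
    (HahnSeries.orderTop_le_of_coeff_ne_zero h₀).trans_lt (HahnSeries.lt_orderTop_of_forall h)
  rw [hres, hres, HahnSeries.orderTop_mul, HahnSeries.orderTop_mul] at hlt
  -- The order of the resultant is a sum over the roots of `F`, so a larger total needs a larger
  -- summand.
  have hex : ∃ y ∈ F.roots, (G.eval y - HahnSeries.C v₀).orderTop <
      (G.eval y - HahnSeries.C v).orderTop := by
    by_contra! hc
    exact absurd hlt (not_lt.mpr (add_le_add le_rfl (HahnSeries.orderTop_prod_le hc)))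
  obtain ⟨y, hy, hlt'⟩ := hex
  -- If `G(y) - v` had order at most `0`, adding the constant `v - v₀` could not lower that order.
  have hpos : (0 : WithTop ℝ) < (G.eval y - HahnSeries.C v).orderTop := by
    by_contra! hle
    have h1 : G.eval y - HahnSeries.C v₀ =
        (G.eval y - HahnSeries.C v) + HahnSeries.C (v - v₀) := by
      rw [map_sub]; ring
    have h2 : (0 : WithTop ℝ) ≤ (HahnSeries.C (v - v₀) : HahnSeries ℝ κ).orderTop :=
      HahnSeries.orderTop_single_le
    have h3 := HahnSeries.min_orderTop_le_orderTop_add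
      (x := G.eval y - HahnSeries.C v) (y := HahnSeries.C (v - v₀))
    rw [← h1, min_eq_left (hle.trans h2)] at h3
    exact absurd hlt' (not_lt.mpr h3)
  have hz : ∀ t ≤ (0 : ℝ), (G.eval y - HahnSeries.C v).coeff t = 0 := fun t ht =>
    HahnSeries.coeff_eq_zero_of_lt_orderTop
      ((WithTop.coe_le_coe.mpr ht).trans_lt (by simpa using hpos))
  refine ⟨y, isRoot_of_mem_roots hy, fun t ht => ?_, ?_⟩
  · have := hz t ht.le
    rwa [HahnSeries.coeff_sub, HahnSeries.C_apply, HahnSeries.coeff_single_of_ne ht.ne,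
      sub_zero] at this
  · have := hz 0 le_rfl
    rwa [HahnSeries.coeff_sub, HahnSeries.C_apply, HahnSeries.coeff_single_same,
      sub_eq_zero] at this

theorem coeff_evalInvT (S : κ[X]) (t : ℝ) (ht : (evalInvT κ S).coeff t ≠ 0) :
    ∃ i : ℕ, t = -i ∧ S.coeff i ≠ 0 := by
  rw [evalInvT, coe_eval₂RingHom, eval₂_eq_sum_range, HahnSeries.coeff_sum] at ht
  obtain ⟨i, -, hi⟩ := Finset.exists_ne_zero_of_sum_ne_zero ht
  rw [HahnSeries.single_pow, HahnSeries.C_apply, HahnSeries.single_mul_single,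
    HahnSeries.coeff_single] at hi
  have h1 : t = 0 + i • (-1 : ℝ) := by
    by_contra hne; rw [if_neg hne] at hi; exact hi rfl
  refine ⟨i, by simpa using h1, fun h0 => ?_⟩
  rw [h0] at hi
  simp at hi

theorem coeff_evalInvT_neg (S : κ[X]) (n : ℕ) : (evalInvT κ S).coeff (-n) = S.coeff n := by
  rw [evalInvT, coe_eval₂RingHom, eval₂_eq_sum_range' _ (n := S.natDegree + 1 + n) (by omega),
    HahnSeries.coeff_sum]
  rw [Finset.sum_eq_single n]
  · rw [HahnSeries.single_pow, HahnSeries.C_apply, HahnSeries.single_mul_single]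
    simp
  · intro i _ hi
    rw [HahnSeries.single_pow, HahnSeries.C_apply, HahnSeries.single_mul_single]
    refine HahnSeries.coeff_single_of_ne fun h => hi ?_
    have h' : (n : ℝ) = i := by simpa using h
    exact_mod_cast h'.symm
  · intro h
    simp only [Finset.mem_range, not_lt] at h
    rw [coeff_eq_zero_of_natDegree_lt (by omega)]
    simp

variable {k : Type*} [Field k]

/-- The bivariate polynomial `P` as a polynomial in its second variable, with coefficients
mapped to a larger ring. -/
noncomputable def polyInYMap {S : Type*} [CommRing S] (f : k →+* S) :
    MvPolynomial (Fin 2) k →+* S[X][X] :=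
  MvPolynomial.eval₂Hom (C.comp (C.comp f)) ![C X, X]

theorem polyInYMap_eq_map {S : Type*} [CommRing S] (f : k →+* S) (P : MvPolynomial (Fin 2) k) :
    polyInYMap f P = (polyInY k P).map (mapRingHom f) := by
  induction P using MvPolynomial.induction_on with
  | C a => simp [polyInY, polyInYMap]
  | add p q hp hq => simp only [map_add, hp, hq, Polynomial.map_add]
  | mul_X p i hp =>
    rw [map_mul, map_mul, Polynomial.map_mul, hp]
    congr 1
    fin_cases i <;> simp [polyInY, polyInYMap]

theorem eval_map_evalInvT (f : k →+* κ) (P : MvPolynomial (Fin 2) k) (y : HahnSeries ℝ κ) :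
    ((polyInYMap f P).map (evalInvT κ)).eval y = evalPuiseux f y P := by
  induction P using MvPolynomial.induction_on with
  | C a => simp [polyInYMap, evalInvT, evalPuiseux]
  | add p q hp hq => simp only [map_add, hp, hq, Polynomial.map_add, eval_add]
  | mul_X p i hp =>
    rw [map_mul, map_mul, Polynomial.map_mul, eval_mul, hp]
    congr 1
    fin_cases i <;> simp [polyInYMap, evalInvT, evalPuiseux]

/-- The resultant in `y` of `P - u` and `Q - v`, for formal degrees `m` and `n`. -/
noncomputable def fiberResultant (P Q : MvPolynomial (Fin 2) k) (m n : ℕ) :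
    (MvPolynomial (Fin 2) k)[X] :=
  resultant (polyInYMap MvPolynomial.C P - C (C (MvPolynomial.X 0)))
    (polyInYMap MvPolynomial.C Q - C (C (MvPolynomial.X 1))) m n

theorem polyInYMap_comp {S T : Type*} [CommRing S] [CommRing T] (f : k →+* S) (g : S →+* T)
    (P : MvPolynomial (Fin 2) k) :
    (polyInYMap f P).map (mapRingHom g) = polyInYMap (g.comp f) P := by
  rw [polyInYMap_eq_map, polyInYMap_eq_map, Polynomial.map_map, mapRingHom_comp]

theorem evalInvT_map_fiberResultant (f : k →+* κ) (P Q : MvPolynomial (Fin 2) k) (m n : ℕ)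
    (u v : κ) :
    evalInvT κ ((fiberResultant P Q m n).map (MvPolynomial.eval₂Hom f ![u, v])) =
      resultant ((polyInYMap f P).map (evalInvT κ) - C (HahnSeries.C u))
        ((polyInYMap f Q).map (evalInvT κ) - C (HahnSeries.C v)) m n := by
  have hc : ∀ (P : MvPolynomial (Fin 2) k) (i : Fin 2),
      ((polyInYMap MvPolynomial.C P - C (C (MvPolynomial.X i))).map
        (mapRingHom (MvPolynomial.eval₂Hom f ![u, v]))).map (evalInvT κ) =
      (polyInYMap f P).map (evalInvT κ) - C (HahnSeries.C (![u, v] i)) := by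
    intro P i
    rw [Polynomial.map_sub, polyInYMap_comp, Polynomial.map_sub,
      show (MvPolynomial.eval₂Hom f ![u, v]).comp MvPolynomial.C = f from
        RingHom.ext fun a => MvPolynomial.eval₂Hom_C _ _ _]
    congr 1
    simp [evalInvT]
  rw [fiberResultant, ← coe_mapRingHom, ← resultant_map_map, ← resultant_map_map, hc, hc]
  rfl

theorem natDegree_map_evalInvT (f : k →+* κ) {P : MvPolynomial (Fin 2) k} {A : k} (hA : A ≠ 0)
    (hPA : (polyInY k P).leadingCoeff = C A) (u : κ) :
    ((polyInYMap f P).map (evalInvT κ) - C (HahnSeries.C u)).natDegree =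
      (polyInY k P).natDegree := by
  rw [natDegree_sub_C, polyInYMap_eq_map, Polynomial.map_map]
  refine natDegree_map_of_leadingCoeff_ne_zero _ ?_
  rw [hPA]
  simpa [evalInvT] using hA

theorem aeval_specialize {L : Type*} [Field L] [Algebra k L] (b : k) (S : MvPolynomial (Fin 2) k)
    (x : L) : (MvPolynomial.eval₂Hom C ![X, C b] S : k[X]).aeval x =
      MvPolynomial.eval₂Hom (algebraMap k L) ![x, algebraMap k L b] S := by
  rw [← AlgHom.coe_toRingHom, ← RingHom.comp_apply]
  congr 1
  ext i
  · simp
  · fin_cases i <;> simp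

section Generic
variable [Algebra k κ] [IsAlgClosed k]

/-- Choose `v` in `k` so that `S(·, v)` is a nonzero polynomial over `k`; the transcendental `u` is
not a root. -/
theorem exists_eval_ne_zero_left {S : MvPolynomial (Fin 2) k} (hS : S ≠ 0) {u : κ}
    (hu : u ∉ (algebraMap k κ).range) :
    ∃ v, MvPolynomial.eval₂Hom (algebraMap k κ) ![u, v] S ≠ 0 := by
  obtain ⟨a, ha⟩ : ∃ a, MvPolynomial.eval a S ≠ 0 := by
    by_contra! h
    exact hS (MvPolynomial.funext fun a => by rw [h, map_zero])
  refine ⟨algebraMap k κ (a 1), ?_⟩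
  rw [← aeval_specialize]
  refine aeval_ne_zero_of_notMem_range hu fun h0 => ha ?_
  have := aeval_specialize (a 1) S (a 0)
  rw [h0, map_zero] at this
  rw [this, MvPolynomial.eval]
  congr 2
  ext i
  fin_cases i <;> rfl

theorem exists_eval_ne_zero_right {S : MvPolynomial (Fin 2) k} (hS : S ≠ 0) {v : κ}
    (hv : v ∉ (algebraMap k κ).range) :
    ∃ u, MvPolynomial.eval₂Hom (algebraMap k κ) ![u, v] S ≠ 0 := by
  have hS' : MvPolynomial.rename (Equiv.swap (0 : Fin 2) 1) S ≠ 0 := fun h =>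
    hS (MvPolynomial.rename_injective _ (Equiv.swap (0 : Fin 2) 1).injective (by rw [h, map_zero]))
  obtain ⟨u, hu⟩ := exists_eval_ne_zero_left hS' hv
  refine ⟨u, fun h => hu ?_⟩
  rw [MvPolynomial.coe_eval₂Hom, MvPolynomial.eval₂_rename]
  rw [MvPolynomial.coe_eval₂Hom] at h
  convert h using 2
  ext i
  fin_cases i <;> rfl

variable [IsAlgClosed κ]

/-- A generic zero of the leading coefficient of the resultant is the limit of `(P, Q)` along a
branch with `x` infinite. -/
theorem exists_branch_at_infinity {P Q : MvPolynomial (Fin 2) k} {A B : k} (hA : A ≠ 0)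
    (hB : B ≠ 0) (hPA : (polyInY k P).leadingCoeff = C A) (hQB : (polyInY k Q).leadingCoeff = C B)
    {u v : κ} (huv : ¬ (u ∈ (algebraMap k κ).range ∧ v ∈ (algebraMap k κ).range))
    (hR : fiberResultant P Q (polyInY k P).natDegree (polyInY k Q).natDegree ≠ 0)
    (h : MvPolynomial.eval₂Hom (algebraMap k κ) ![u, v]
      (fiberResultant P Q (polyInY k P).natDegree (polyInY k Q).natDegree).leadingCoeff = 0) :
    ∃ y, VanishesBelow 0 (evalPuiseux (algebraMap k κ) y P) ∧
      (evalPuiseux (algebraMap k κ) y P).coeff 0 = u ∧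
      VanishesBelow 0 (evalPuiseux (algebraMap k κ) y Q) ∧
      (evalPuiseux (algebraMap k κ) y Q).coeff 0 = v := by
  set f := algebraMap k κ with hf
  set m := (polyInY k P).natDegree with hm
  set n := (polyInY k Q).natDegree with hn
  set R := fiberResultant P Q m n with hRdef
  set FP := (polyInYMap f P).map (evalInvT κ) with hFP
  set FQ := (polyInYMap f Q).map (evalInvT κ) with hFQ
  have hPd : ∀ u, (FP - C (HahnSeries.C u)).natDegree = m := natDegree_map_evalInvT f hA hPA
  have hQd : ∀ u, (FQ - C (HahnSeries.C u)).natDegree = n := natDegree_map_evalInvT f hB hQB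
  -- At `x = 1/t` the coefficient of `x^N` sits at exponent `-N`. It vanishes at `(u, v)`, whereas
  -- changing one coordinate makes it nonzero.
  have hsmall : ∀ t ≤ -(R.natDegree : ℝ),
      (resultant (FP - C (HahnSeries.C u)) (FQ - C (HahnSeries.C v)) m n).coeff t = 0 := by
    intro t ht
    by_contra hne
    rw [← evalInvT_map_fiberResultant] at hne
    obtain ⟨i, rfl, hi⟩ := coeff_evalInvT _ _ hne
    rw [coeff_map] at hi
    have h1 : (R.natDegree : ℝ) ≤ i := by linarith
    rcases (Nat.cast_le.mp h1).eq_or_lt with h2 | h2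
    · rw [← h2, coeff_natDegree] at hi
      exact hi h
    · rw [coeff_eq_zero_of_natDegree_lt h2, map_zero] at hi
      exact hi rfl
  have hlarge : ∀ u v, MvPolynomial.eval₂Hom f ![u, v] R.leadingCoeff ≠ 0 →
      (resultant (FP - C (HahnSeries.C u)) (FQ - C (HahnSeries.C v)) m n).coeff
        (-(R.natDegree : ℝ)) ≠ 0 := by
    intro u v huv
    rw [← evalInvT_map_fiberResultant, coeff_evalInvT_neg, coeff_map]
    exact huv
  have hclose : ∀ (P : MvPolynomial (Fin 2) k) (u : κ) (y : HahnSeries ℝ κ),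
      ((polyInYMap f P).map (evalInvT κ) - C (HahnSeries.C u)).eval y = 0 →
      VanishesBelow 0 (evalPuiseux f y P) ∧ (evalPuiseux f y P).coeff 0 = u := by
    intro P u y hy
    rw [eval_sub, eval_C, eval_map_evalInvT, sub_eq_zero] at hy
    rw [hy, HahnSeries.C_apply]
    exact ⟨VanishesBelow.single _ _, HahnSeries.coeff_single_same _ _⟩
  have hR0 : R.leadingCoeff ≠ 0 := leadingCoeff_ne_zero.mpr hR
  -- The transcendental coordinate is kept and the other one varied. When only `v` is
  -- transcendental, the two polynomials swap roles.
  by_cases hu : u ∈ f.range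
  · have hv : v ∉ f.range := fun hv => huv ⟨hu, hv⟩
    obtain ⟨u₀, hu₀⟩ := exists_eval_ne_zero_right hR0 hv
    have hcomm : ∀ (u : κ) (t : ℝ),
        (resultant (FP - C (HahnSeries.C u)) (FQ - C (HahnSeries.C v)) m n).coeff t = 0 ↔
        (resultant (FQ - C (HahnSeries.C v)) (FP - C (HahnSeries.C u)) n m).coeff t = 0 := by
      intro u t
      rw [resultant_comm]
      rcases neg_one_pow_eq_or (HahnSeries ℝ κ) (m * n) with h | h <;> rw [h] <;> simp
    obtain ⟨y, hy, h1, h2⟩ := exists_root_of_resultant_order (F := FQ - C (HahnSeries.C v))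
      (G := FP) (n := m) (v := u) (v₀ := u₀) (s := -(R.natDegree : ℝ))
      (by rw [← hPd 0, map_zero, map_zero, sub_zero])
      (by rw [hQd, Ne, ← hcomm]; exact hlarge _ _ hu₀)
      (fun t ht => by rw [hQd, ← hcomm]; exact hsmall t ht)
    rw [eval_map_evalInvT] at h1 h2
    obtain ⟨h3, h4⟩ := hclose Q v y hy
    exact ⟨y, h1, h2, h3, h4⟩
  · obtain ⟨v₀, hv₀⟩ := exists_eval_ne_zero_left hR0 hu
    obtain ⟨y, hy, h1, h2⟩ := exists_root_of_resultant_order (F := FP - C (HahnSeries.C u))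
      (G := FQ) (n := n) (v := v) (v₀ := v₀) (s := -(R.natDegree : ℝ))
      (by rw [← hQd 0, map_zero, map_zero, sub_zero])
      (by rw [hPd]; exact hlarge _ _ hv₀)
      (fun t ht => by rw [hPd]; exact hsmall t ht)
    rw [eval_map_evalInvT] at h1 h2
    obtain ⟨h3, h4⟩ := hclose P u y hy
    exact ⟨y, h3, h4, h1, h2⟩

end Generic

end Branch

/-! ### Top weighted forms of resultants -/

section TopResultant
variable {R : Type*} [CommRing R]

theorem VanishesBelow.leadingCoeff_eq {a : ℝ} {x : HahnSeries ℝ R} (hx : VanishesBelow a x)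
    (h : x.coeff a ≠ 0) : x.leadingCoeff = x.coeff a := by
  have hx0 : x ≠ 0 := HahnSeries.ne_zero_of_coeff_ne_zero h
  rw [HahnSeries.leadingCoeff_eq,
    le_antisymm (HahnSeries.order_le_of_coeff_ne_zero h) (hx.le_order hx0)]

theorem leadingCoeff_eval₂_single {r : ℝ} (hr : 0 < r) {S : R[X]} (hS : S.coeff 0 ≠ 0) :
    (S.eval₂ HahnSeries.C (HahnSeries.single r 1)).leadingCoeff = S.coeff 0 := by
  have hv : ∀ S : R[X], VanishesBelow 0 (S.eval₂ HahnSeries.C (HahnSeries.single r 1)) := by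
    intro S
    rw [eval₂_eq_sum_range]
    refine VanishesBelow.sum fun i _ => ?_
    have h1 : VanishesBelow 0 (HahnSeries.C (S.coeff i) : HahnSeries ℝ R) :=
      VanishesBelow.single 0 _
    refine (h1.mul ((VanishesBelow.single r (1 : R)).pow i)).mono ?_
    positivity
  have hc : (S.eval₂ HahnSeries.C (HahnSeries.single r 1)).coeff 0 = S.coeff 0 := by
    conv_lhs => rw [← divX_mul_X_add S]
    rw [eval₂_add, eval₂_mul, eval₂_X, eval₂_C, HahnSeries.coeff_add, HahnSeries.C_apply,
      HahnSeries.coeff_single_same,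
      ((hv S.divX).mul (VanishesBelow.single r (1 : R))) 0 (by linarith), zero_add]
  rw [(hv S).leadingCoeff_eq (by rwa [hc]), hc]

theorem natDegree_map_C_sub_C (p : R[X]) (x : HahnSeries ℝ R) :
    (p.map HahnSeries.C - C x).natDegree = p.natDegree := by
  rw [natDegree_sub_C, natDegree_map_eq_of_injective HahnSeries.C_injective]

theorem map_eval_zero_scaleRoots_sub_C {p : R[X]} {n : ℕ} (hp : p.natDegree = n) (u : R) :
    ((p.map C).scaleRoots X - C (C u)).map (evalRingHom 0) =
      C p.leadingCoeff * X ^ n - C u := by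
  ext1 i
  rw [coeff_map, coeff_sub, coeff_sub, coeff_scaleRoots, coeff_map, coeff_C_mul_X_pow,
    natDegree_map_eq_of_injective C_injective, hp, map_sub, map_mul, map_pow]
  congr 1
  · rcases lt_trichotomy i n with h | h | h
    · rw [if_neg h.ne]
      simp [Nat.sub_ne_zero_of_lt h]
    · rw [if_pos h, h, ← hp]
      simp
    · rw [if_neg h.ne', coeff_eq_zero_of_natDegree_lt (hp ▸ h)]
      simp
  · rw [coeff_C, coeff_C]
    split_ifs <;> simp

/-- Scaling roots by `t^(1/j)` multiplies the constant term by `t^d`. This cancels `t^(-d)` on `u`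
and leaves a polynomial in `t^(1/j)`, whose value at `0` is the top binomial. -/
theorem scaleRoots_map_C_sub_C {p : R[X]} {d j : ℕ} (hj : j ≠ 0) (hp : p.natDegree = d * j)
    (u : R) :
    (p.map HahnSeries.C - C (HahnSeries.single (-d : ℝ) u)).scaleRoots
        (HahnSeries.single (1 / j : ℝ) 1) =
      ((p.map C).scaleRoots X - C (C u)).map
        (eval₂RingHom HahnSeries.C (HahnSeries.single (1 / j : ℝ) 1)) := by
  have hj' : (j : ℝ) ≠ 0 := by exact_mod_cast hj
  set T : HahnSeries ℝ R := HahnSeries.single (1 / j : ℝ) 1 with hT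
  have hX : eval₂RingHom HahnSeries.C T X = T := eval₂_X _ _
  have hCx : ∀ x, eval₂RingHom HahnSeries.C T (C x) = HahnSeries.C x := fun x => eval₂_C _ _
  ext1 i
  rw [coeff_scaleRoots, coeff_map, coeff_sub, coeff_sub, coeff_scaleRoots, coeff_map, coeff_map,
    natDegree_map_C_sub_C, natDegree_map_eq_of_injective C_injective, hp, map_sub, map_mul,
    map_pow, sub_mul, hX, hCx]
  congr 1
  rcases Nat.eq_zero_or_pos i with rfl | hi
  · rw [coeff_C_zero, coeff_C_zero, hCx, hT, HahnSeries.single_pow,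
      HahnSeries.single_mul_single, HahnSeries.C_apply, one_pow, mul_one, Nat.sub_zero]
    congr 2
    rw [nsmul_eq_mul, Nat.cast_mul, mul_assoc, mul_one_div_cancel hj', mul_one, neg_add_cancel]
  · rw [coeff_C_of_ne_zero hi.ne', coeff_C_of_ne_zero hi.ne', zero_mul, map_zero]

variable [IsDomain R]

/-- With weights `d` for `u` and `e` for `v`, the top form of `Res(p - u, q - v)` is the resultant
of the top forms. -/
theorem leadingCoeff_weighted_resultant {p q : R[X]} {d e j : ℕ} (hj : j ≠ 0)
    (hp : p.natDegree = d * j) (hq : q.natDegree = e * j) (u v : R)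
    (h0 : resultant (C p.leadingCoeff * X ^ (d * j) - C u) (C q.leadingCoeff * X ^ (e * j) - C v)
      (d * j) (e * j) ≠ 0) :
    (resultant (p.map HahnSeries.C - C (HahnSeries.single (-d : ℝ) u))
      (q.map HahnSeries.C - C (HahnSeries.single (-e : ℝ) v)) (d * j) (e * j)).leadingCoeff =
    resultant (C p.leadingCoeff * X ^ (d * j) - C u) (C q.leadingCoeff * X ^ (e * j) - C v)
      (d * j) (e * j) := by
  set E := resultant ((p.map C).scaleRoots X - C (C u)) ((q.map C).scaleRoots X - C (C v))
    (d * j) (e * j) with hE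
  have hE0 : E.coeff 0 = resultant (C p.leadingCoeff * X ^ (d * j) - C u)
      (C q.leadingCoeff * X ^ (e * j) - C v) (d * j) (e * j) := by
    rw [← map_eval_zero_scaleRoots_sub_C hp u, ← map_eval_zero_scaleRoots_sub_C hq v,
      resultant_map_map, coeff_zero_eq_eval_zero, coe_evalRingHom]
  have hθE : eval₂RingHom HahnSeries.C (HahnSeries.single (1 / j : ℝ) 1) E =
      HahnSeries.single (1 / j : ℝ) 1 ^ (d * j * (e * j)) *
      resultant (p.map HahnSeries.C - C (HahnSeries.single (-d : ℝ) u))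
        -- Scaling all roots multiplies the resultant by a power of `t^(1/j)`, which does not affect
        -- the leading coefficient.
        (q.map HahnSeries.C - C (HahnSeries.single (-e : ℝ) v)) (d * j) (e * j) := by
    rw [hE, ← resultant_map_map, ← scaleRoots_map_C_sub_C hj hp, ← scaleRoots_map_C_sub_C hj hq]
    have := resultant_scaleRoots (p.map HahnSeries.C - C (HahnSeries.single (-d : ℝ) u))
      (q.map HahnSeries.C - C (HahnSeries.single (-e : ℝ) v)) (HahnSeries.single (1 / j : ℝ) 1)
    rwa [natDegree_scaleRoots, natDegree_scaleRoots, natDegree_map_C_sub_C, natDegree_map_C_sub_C,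
      hp, hq] at this
  have hpos : (0 : ℝ) < 1 / j := by positivity
  have hl := leadingCoeff_eval₂_single hpos (S := E) (by rwa [hE0])
  have hl' := congrArg HahnSeries.leadingCoeff hθE
  rw [HahnSeries.leadingCoeff_mul, HahnSeries.single_pow, HahnSeries.leadingCoeff_of_single,
    one_pow, one_mul, coe_eval₂RingHom] at hl'
  rw [← hl', ← hE0, ← hl]

/-- Modulo `f`, a multiple of `g` is congruent to the constant `β^d u^e - α^e v^d`, because
`X^(dej)` can be eliminated. The resultant of `f` with that constant is explicit. -/
theorem resultant_X_pow_sub_dvd {α β u v : R} (hα : α ≠ 0) (hβ : β ≠ 0) {d e j : ℕ}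
    (hdj : d * j ≠ 0) (hej : e * j ≠ 0) (h0 : β ^ d * u ^ e - α ^ e * v ^ d ≠ 0) :
    ∃ n, resultant (C α * X ^ (d * j) - C u) (C β * X ^ (e * j) - C v) (d * j) (e * j) ∣
      α ^ n * (β ^ d * u ^ e - α ^ e * v ^ d) ^ (d * j) := by
  set f : R[X] := C α * X ^ (d * j) - C u with hf
  set g : R[X] := C β * X ^ (e * j) - C v with hg
  have hfd : f.natDegree = d * j := by rw [hf, natDegree_sub_C, natDegree_C_mul_X_pow _ _ hα]
  have hgd : g.natDegree = e * j := by rw [hg, natDegree_sub_C, natDegree_C_mul_X_pow _ _ hβ]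
  have hg0 : g ≠ 0 := by rintro h; rw [h, natDegree_zero] at hgd; exact hej hgd.symm
  have hf0 : f ≠ 0 := by rintro h; rw [h, natDegree_zero] at hfd; exact hdj hfd.symm
  obtain ⟨h, hh⟩ : g ∣ (C β * X ^ (e * j)) ^ d - C v ^ d := sub_dvd_pow_sub_pow _ _ d
  obtain ⟨w, hw⟩ : f ∣ (C α * X ^ (d * j)) ^ e - C u ^ e := sub_dvd_pow_sub_pow _ _ e
  set G := β ^ d * u ^ e - α ^ e * v ^ d with hG
  have key : g * (C α ^ e * h) = C G + f * (C β ^ d * w) := by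
    have : g * (C α ^ e * h) = C α ^ e * (g * h) := by ring
    rw [this, ← hh]
    have : f * (C β ^ d * w) = C β ^ d * (f * w) := by ring
    rw [this, ← hw, hG]
    simp only [C_sub, C_mul, C_pow, mul_pow, ← pow_mul]
    rw [show e * j * d = d * j * e by ring]
    ring
  have hne : g * (C α ^ e * h) ≠ 0 := by
    intro hz
    have hfw : f ∣ C G := ⟨-(C β ^ d * w), by rw [hz] at key; linear_combination -key⟩
    have := natDegree_le_of_dvd hfw (C_ne_zero.mpr h0)
    rw [natDegree_C, hfd] at this
    omega
  have hh0 : C α ^ e * h ≠ 0 := right_ne_zero_of_mul hne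
  have hmul := resultant_mul_right f g (C α ^ e * h) (d * j) hfd.le
  rw [hgd] at hmul
  set n := e * j + (C α ^ e * h).natDegree with hn
  have hgn : (g * (C α ^ e * h)).natDegree = n := by rw [natDegree_mul hg0 hh0, hgd]
  -- Reduction modulo `f` needs the multiplier to fit the formal degree `n`; the zero multiplier is
  -- treated apart.
  have hwd : (C β ^ d * w) = 0 ∨ (C β ^ d * w).natDegree + d * j ≤ n := by
    by_cases hw0 : C β ^ d * w = 0
    · exact Or.inl hw0
    · right
      have h1 : (f * (C β ^ d * w)).natDegree ≤ n := by
        rw [show f * (C β ^ d * w) = g * (C α ^ e * h) - C G by rw [key]; ring, natDegree_sub_C,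
          hgn]
      rwa [natDegree_mul hf0 hw0, hfd, add_comm] at h1
  have hres : resultant f (C G + f * (C β ^ d * w)) (d * j) n = α ^ n * G ^ (d * j) := by
    have h1 : resultant f (C G + f * (C β ^ d * w)) (d * j) n = resultant f (C G) (d * j) n := by
      rcases hwd with hw0 | hw0
      · rw [hw0, mul_zero, add_zero]
      · exact resultant_add_mul_right _ _ _ _ _ hw0 hfd.le
    rw [h1, resultant_C_right]
    congr 2
    rw [hf, coeff_sub, coeff_C_mul_X_pow, if_pos rfl, coeff_C_of_ne_zero hdj, sub_zero]
  refine ⟨n, ⟨resultant f (C α ^ e * h) (d * j), ?_⟩⟩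
  rw [← hmul, key, hres]

end TopResultant

/-! ### Weighted forms and the prime binomial -/

section QuasiHomogeneous
variable {k : Type*} [Field k]

/-- The homomorphism recording weights: the two variables get weights `d` and `e`, and a form of
weight `w` is placed at the exponent `-w`. -/
noncomputable def weightMap (k : Type*) [Field k] (d e : ℕ) :
    MvPolynomial (Fin 2) k →+* HahnSeries ℝ (MvPolynomial (Fin 2) k) :=
  MvPolynomial.eval₂Hom (HahnSeries.C.comp MvPolynomial.C)
    ![HahnSeries.single (-d : ℝ) (MvPolynomial.X 0),
      HahnSeries.single (-e : ℝ) (MvPolynomial.X 1)]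

theorem weightMap_C (d e : ℕ) (a : k) :
    weightMap k d e (MvPolynomial.C a) = HahnSeries.single 0 (MvPolynomial.C a) :=
  MvPolynomial.eval₂Hom_C _ _ _

theorem weightMap_X_zero (d e : ℕ) :
    weightMap k d e (MvPolynomial.X 0) = HahnSeries.single (-d : ℝ) (MvPolynomial.X 0) :=
  MvPolynomial.eval₂Hom_X' _ _ _

theorem weightMap_X_one (d e : ℕ) :
    weightMap k d e (MvPolynomial.X 1) = HahnSeries.single (-e : ℝ) (MvPolynomial.X 1) :=
  MvPolynomial.eval₂Hom_X' _ _ _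

theorem weightMap_monomial (d e : ℕ) (m : Fin 2 →₀ ℕ) (a : k) :
    weightMap k d e (MvPolynomial.monomial m a) =
      HahnSeries.single (-(d * m 0 + e * m 1 : ℝ)) (MvPolynomial.monomial m a) := by
  rw [weightMap, MvPolynomial.eval₂Hom_monomial, Finsupp.prod_fintype _ _ (by simp),
    Fin.prod_univ_two, RingHom.comp_apply, HahnSeries.C_apply]
  simp only [Matrix.cons_val_zero, Matrix.cons_val_one, HahnSeries.single_pow,
    HahnSeries.single_mul_single, nsmul_eq_mul]
  congr 1
  · ring_nf
  · rw [MvPolynomial.monomial_eq, Finsupp.prod_fintype _ _ (by simp), Fin.prod_univ_two]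

theorem coeff_coeff_weightMap (d e : ℕ) (F : MvPolynomial (Fin 2) k) (s : ℝ) (m : Fin 2 →₀ ℕ) :
    ((weightMap k d e F).coeff s).coeff m =
      if s = -(d * m 0 + e * m 1 : ℝ) then F.coeff m else 0 := by
  induction F using MvPolynomial.induction_on' with
  | monomial n a =>
    rw [weightMap_monomial, HahnSeries.coeff_single, MvPolynomial.coeff_monomial]
    by_cases h : n = m
    · subst h
      rw [if_pos (rfl : n = n)]
      split_ifs
      · rw [MvPolynomial.coeff_monomial, if_pos rfl]
      · rfl
    · rw [if_neg h, ite_self]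
      split_ifs
      · rw [MvPolynomial.coeff_monomial, if_neg h]
      · rfl
  | add p q hp hq =>
    rw [map_add, HahnSeries.coeff_add, MvPolynomial.coeff_add, hp, hq, MvPolynomial.coeff_add]
    split_ifs <;> simp

theorem weightMap_injective (d e : ℕ) : Function.Injective (weightMap k d e) := by
  rw [injective_iff_map_eq_zero]
  intro F hF
  ext m
  have := coeff_coeff_weightMap d e F (-(d * m 0 + e * m 1 : ℝ)) m
  rw [if_pos rfl, hF] at this
  simpa using this.symm

/-- The part of highest weight, for weights `d` and `e` of the two variables. -/
noncomputable def topForm (d e : ℕ) (F : MvPolynomial (Fin 2) k) : MvPolynomial (Fin 2) k :=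
  (weightMap k d e F).leadingCoeff

theorem topForm_mul (d e : ℕ) (F H : MvPolynomial (Fin 2) k) :
    topForm d e (F * H) = topForm d e F * topForm d e H := by
  rw [topForm, map_mul, HahnSeries.leadingCoeff_mul, topForm, topForm]

theorem topForm_ne_zero (d e : ℕ) {F : MvPolynomial (Fin 2) k} (hF : F ≠ 0) :
    topForm d e F ≠ 0 :=
  HahnSeries.leadingCoeff_ne_zero.mpr ((map_ne_zero_iff _ (weightMap_injective d e)).mpr hF)

theorem topForm_C (d e : ℕ) (a : k) :
    topForm d e (MvPolynomial.C a : MvPolynomial (Fin 2) k) = MvPolynomial.C a := by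
  rw [topForm, weightMap_C]
  exact HahnSeries.leadingCoeff_of_single

theorem coeff_topForm (d e : ℕ) (F : MvPolynomial (Fin 2) k) (m : Fin 2 →₀ ℕ) :
    (topForm d e F).coeff m =
      if (weightMap k d e F).order = -(d * m 0 + e * m 1 : ℝ) then F.coeff m else 0 := by
  rw [topForm, HahnSeries.leadingCoeff_eq, coeff_coeff_weightMap]

theorem weight_lt_of_mem_support_sub_topForm {d e : ℕ} {F : MvPolynomial (Fin 2) k}
    {m : Fin 2 →₀ ℕ} (hm : m ∈ (F - topForm d e F).support) :
    (d * m 0 + e * m 1 : ℝ) < -(weightMap k d e F).order := by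
  rw [MvPolynomial.mem_support_iff, MvPolynomial.coeff_sub, coeff_topForm] at hm
  have hne : (weightMap k d e F).order ≠ -(d * m 0 + e * m 1 : ℝ) := by
    intro h; rw [if_pos h, sub_self] at hm; exact hm rfl
  rw [if_neg hne, sub_zero] at hm
  have h1 : (weightMap k d e F).coeff (-(d * m 0 + e * m 1 : ℝ)) ≠ 0 := by
    intro h0
    have := coeff_coeff_weightMap d e F (-(d * m 0 + e * m 1 : ℝ)) m
    rw [h0, if_pos rfl, MvPolynomial.coeff_zero] at this
    exact hm this.symm
  have := lt_of_le_of_ne (HahnSeries.order_le_of_coeff_ne_zero h1) hne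
  linarith

/-- The form `B ^ d u ^ e - A ^ e v ^ d`. -/
noncomputable def quasiForm (A B : k) (d e : ℕ) : MvPolynomial (Fin 2) k :=
  MvPolynomial.C (B ^ d) * MvPolynomial.X 0 ^ e - MvPolynomial.C (A ^ e) * MvPolynomial.X 1 ^ d

theorem weightMap_quasiForm (A B : k) (d e : ℕ) :
    weightMap k d e (quasiForm A B d e) =
      HahnSeries.single (-(d * e : ℝ)) (quasiForm A B d e) := by
  rw [quasiForm, map_sub, map_mul, map_mul, map_pow (weightMap k d e),
    map_pow (weightMap k d e), weightMap_C, weightMap_C, weightMap_X_zero, weightMap_X_one, HahnSeries.single_pow, HahnSeries.single_pow,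
    HahnSeries.single_mul_single, HahnSeries.single_mul_single, nsmul_eq_mul, nsmul_eq_mul,
    show (0 + (e : ℝ) * -(d : ℝ)) = -(d * e : ℝ) by ring,
    show (0 + (d : ℝ) * -(e : ℝ)) = -(d * e : ℝ) by ring, HahnSeries.single_sub]

section Prime
variable (A B : k) (d e : ℕ)

/-- The parametrization `t ↦ (A t ^ d, B t ^ e)` of the curve `B ^ d u ^ e = A ^ e v ^ d`. -/
noncomputable def quasiParam : MvPolynomial (Fin 2) k →+* k[X] :=
  MvPolynomial.eval₂Hom C ![C A * X ^ d, C B * X ^ e]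

theorem quasiParam_quasiForm : quasiParam A B d e (quasiForm A B d e) = 0 := by
  simp only [quasiForm, quasiParam, map_sub, map_mul, map_pow, MvPolynomial.coe_eval₂Hom,
    MvPolynomial.eval₂_X, Matrix.cons_val_zero, Matrix.cons_val_one, MvPolynomial.eval₂_C]
  ring

variable {A B d e}

/-- Division with remainder in `u`, possible because the coefficient `B^d` of `u^e` is a unit. -/
theorem exists_reduction_quasiForm (hB : B ≠ 0) (he : e ≠ 0) (F : MvPolynomial (Fin 2) k) :
    ∃ g : ℕ → k[X], quasiForm A B d e ∣
      F - ∑ i ∈ Finset.range e, MvPolynomial.X 0 ^ i * (g i).aeval (MvPolynomial.X 1) := by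
  obtain ⟨n, rfl⟩ := Nat.exists_eq_succ_of_ne_zero he
  induction F using MvPolynomial.induction_on with
  | C a =>
    refine ⟨fun i => if i = 0 then C a else 0, ?_⟩
    rw [Finset.sum_eq_single 0]
    · simp [MvPolynomial.algebraMap_eq]
    · intro i _ hi; simp [hi]
    · simp
  | add p q hp hq =>
    obtain ⟨g, hg⟩ := hp
    obtain ⟨h, hh⟩ := hq
    refine ⟨fun i => g i + h i, ?_⟩
    simp only [map_add, mul_add, Finset.sum_add_distrib]
    convert dvd_add hg hh using 1
    ring
  | mul_X p i hp =>
    obtain ⟨g, hg⟩ := hp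
    have hg' := hg.mul_right (MvPolynomial.X i)
    fin_cases i
    -- Multiplication by `u` shifts the coefficients; the overflow `u^e` is replaced by `A^e B^(-d)
    -- v^d`.
    · refine ⟨fun i => if i = 0 then C (A ^ (n + 1) * (B ^ d)⁻¹) * X ^ d * g n else g (i - 1), ?_⟩
      have hB' : (MvPolynomial.C ((B ^ d)⁻¹) * MvPolynomial.C (B ^ d) :
          MvPolynomial (Fin 2) k) = 1 := by
        rw [← MvPolynomial.C_mul, inv_mul_cancel₀ (pow_ne_zero _ hB), MvPolynomial.C_1]
      have h2 : quasiForm A B d (n + 1) ∣ quasiForm A B d (n + 1) *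
          (MvPolynomial.C ((B ^ d)⁻¹) * (g n).aeval (MvPolynomial.X 1)) := dvd_mul_right _ _
      convert dvd_add hg' h2 using 1
      rw [Finset.sum_range_succ', Finset.sum_range_succ]
      simp only [Nat.succ_ne_zero, if_false, if_true, Nat.add_sub_cancel, Fin.zero_eta,
        quasiForm, map_mul, aeval_C, aeval_X, map_pow, MvPolynomial.algebraMap_eq, sub_mul,
        add_mul, Finset.sum_mul, pow_zero, one_mul] at hB' ⊢
      have h3 : ∑ i ∈ Finset.range n, (MvPolynomial.X 0 : MvPolynomial (Fin 2) k) ^ (i + 1) *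
            (g i).aeval (MvPolynomial.X 1 : MvPolynomial (Fin 2) k) =
          ∑ i ∈ Finset.range n, MvPolynomial.X 0 ^ i * (g i).aeval (MvPolynomial.X 1) *
            MvPolynomial.X 0 := Finset.sum_congr rfl fun i _ => by ring
      rw [h3]
      linear_combination (-(MvPolynomial.X 0 : MvPolynomial (Fin 2) k) ^ (n + 1) *
        (g n).aeval (MvPolynomial.X 1 : MvPolynomial (Fin 2) k)) * hB'
    · refine ⟨fun i => g i * X, ?_⟩
      convert hg' using 1
      simp only [map_mul, aeval_X, sub_mul, Finset.sum_mul, Fin.mk_one, mul_assoc]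

/-- The binomial generates the kernel of the parametrization: in a remainder of `u`-degree below
`e`, the summands have exponents in distinct classes `d i` modulo `e`, so they cannot cancel. -/
theorem quasiForm_dvd_of_quasiParam_eq_zero (hA : A ≠ 0) (hB : B ≠ 0) (he : e ≠ 0)
    (hde : d.Coprime e) {F : MvPolynomial (Fin 2) k} (hF : quasiParam A B d e F = 0) :
    quasiForm A B d e ∣ F := by
  obtain ⟨g, hg⟩ := exists_reduction_quasiForm (A := A) (d := d) hB he F
  have hθ : ∀ h : k[X], quasiParam A B d e (h.aeval (MvPolynomial.X 1)) =
      expand k e (h.comp (C B * X)) := by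
    intro h
    induction h using Polynomial.induction_on' with
    | add p q hp hq => simp only [map_add, add_comp, hp, hq]
    | monomial n a =>
      rw [← C_mul_X_pow_eq_monomial]
      simp [quasiParam, mul_pow, MvPolynomial.algebraMap_eq]
  have hsum : ∑ i ∈ Finset.range e, C (A ^ i) *
      (expand k e ((g i).comp (C B * X)) * X ^ (d * i)) = 0 := by
    obtain ⟨w, hw⟩ := hg
    have h1 := congrArg (quasiParam A B d e) hw
    rw [map_sub, hF, map_mul, quasiParam_quasiForm, zero_mul, zero_sub, neg_eq_zero, map_sum] at h1
    rw [← h1]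
    refine Finset.sum_congr rfl fun i _ => ?_
    rw [map_mul, hθ, map_pow (quasiParam A B d e), C_pow, show quasiParam A B d e (MvPolynomial.X 0) = C A * X ^ d from
      MvPolynomial.eval₂Hom_X' _ _ _, mul_pow, ← pow_mul]
    ring
  have hg0 : ∀ i ∈ Finset.range e, g i = 0 := by
    intro i hi
    ext m
    have h1 := congrArg (fun p => p.coeff (e * m + d * i)) hsum
    simp only [finsetSum_coeff, coeff_C_mul, coeff_zero] at h1
    rw [Finset.sum_eq_single i] at h1
    · rw [coeff_mul_X_pow, mul_comm e m, coeff_expand_mul (Nat.pos_of_ne_zero he),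
        comp_C_mul_X_coeff] at h1
      simpa [hA, hB] using h1
    · intro l hl hli
      rw [coeff_mul_X_pow', coeff_expand (Nat.pos_of_ne_zero he)]
      split_ifs with h2 h3
      · exfalso
        refine hli ?_
        rw [Finset.mem_range] at hi hl
        have h4 : e * m + d * i ≡ d * l [MOD e] :=
          ((Nat.modEq_iff_dvd' h2).mpr h3).symm
        have h5 : d * i ≡ d * l [MOD e] := by
          have : e * m + d * i ≡ 0 + d * i [MOD e] :=
            Nat.ModEq.add_right _ (Nat.modEq_zero_iff_dvd.mpr (dvd_mul_right _ _))
          rw [zero_add] at this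
          exact this.symm.trans h4
        have h6 : i ≡ l [MOD e] := Nat.ModEq.cancel_left_of_coprime hde.symm h5
        exact (Nat.ModEq.eq_of_lt_of_lt h6 hi hl).symm
      all_goals simp
    · intro h; exact absurd hi h
  rw [Finset.sum_eq_zero fun i hi => by rw [hg0 i hi, map_zero, mul_zero], sub_zero] at hg
  exact hg

theorem quasiForm_ne_zero (hB : B ≠ 0) (hd : d ≠ 0) : quasiForm A B d e ≠ 0 := by
  intro h
  have := congrArg (MvPolynomial.eval ![1, 0]) h
  simp [quasiForm, hd, hB] at this

theorem quasiForm_prime (hA : A ≠ 0) (hB : B ≠ 0) (hd : d ≠ 0) (he : e ≠ 0)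
    (hde : d.Coprime e) : Prime (quasiForm A B d e) := by
  refine ⟨quasiForm_ne_zero hB hd, fun hu => ?_, fun F H h => ?_⟩
  · have := hu.map (quasiParam A B d e)
    rw [quasiParam_quasiForm] at this
    exact not_isUnit_zero this
  · obtain ⟨w, hw⟩ := h
    have h1 := congrArg (quasiParam A B d e) hw
    rw [map_mul, map_mul, quasiParam_quasiForm, zero_mul, mul_eq_zero] at h1
    exact h1.imp (quasiForm_dvd_of_quasiParam_eq_zero hA hB he hde)
      (quasiForm_dvd_of_quasiParam_eq_zero hA hB he hde)

end Prime

/-- The equation of the curve parametrized by the polynomials `p` and `q`. -/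
noncomputable def curveResultant (p q : k[X]) (m n : ℕ) : MvPolynomial (Fin 2) k :=
  resultant (p.map MvPolynomial.C - C (MvPolynomial.X 0))
    (q.map MvPolynomial.C - C (MvPolynomial.X 1)) m n

theorem weightMap_curveResultant (p q : k[X]) (d e m n : ℕ) :
    weightMap k d e (curveResultant p q m n) =
      resultant ((p.map MvPolynomial.C).map HahnSeries.C -
          C (HahnSeries.single (-d : ℝ) (MvPolynomial.X 0)))
        ((q.map MvPolynomial.C).map HahnSeries.C -
          C (HahnSeries.single (-e : ℝ) (MvPolynomial.X 1))) m n := by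
  have h : (weightMap k d e).comp MvPolynomial.C = HahnSeries.C.comp MvPolynomial.C :=
    RingHom.ext fun a => MvPolynomial.eval₂Hom_C _ _ _
  rw [curveResultant, ← resultant_map_map, Polynomial.map_sub, Polynomial.map_sub,
    Polynomial.map_map, Polynomial.map_map, h, Polynomial.map_C, Polynomial.map_C,
    Polynomial.map_map, Polynomial.map_map, weightMap_X_zero, weightMap_X_one]

/-- The top form is the resultant of the top binomials, and the relation between leading
coefficients makes the binomials for `(α, β)` and `(A, B)` associates. -/
theorem topForm_curveResultant {A B : k} (hA : A ≠ 0) {p q : k[X]} {d e j : ℕ}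
    (hd : d ≠ 0) (he : e ≠ 0) (hj : j ≠ 0) (hp : p.natDegree = d * j) (hq : q.natDegree = e * j)
    (hpq : B ^ d * p.leadingCoeff ^ e = A ^ e * q.leadingCoeff ^ d) :
    curveResultant p q (d * j) (e * j) ≠ 0 ∧
      ∃ n, topForm d e (curveResultant p q (d * j) (e * j)) ∣ quasiForm A B d e ^ n := by
  have hα : p.leadingCoeff ≠ 0 := by
    rw [leadingCoeff_ne_zero]; rintro rfl; rw [natDegree_zero] at hp
    exact mul_ne_zero hd hj hp.symm
  have hβ : q.leadingCoeff ≠ 0 := by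
    rw [leadingCoeff_ne_zero]; rintro rfl; rw [natDegree_zero] at hq
    exact mul_ne_zero he hj hq.symm
  set α := p.leadingCoeff with hαd
  set β := q.leadingCoeff with hβd
  have hC : ∀ {a : k}, a ≠ 0 → (MvPolynomial.C a : MvPolynomial (Fin 2) k) ≠ 0 := fun h =>
    (map_ne_zero_iff _ (MvPolynomial.C_injective _ _)).mpr h
  have hG' : MvPolynomial.C β ^ d * MvPolynomial.X 0 ^ e -
      MvPolynomial.C α ^ e * MvPolynomial.X 1 ^ d = quasiForm α β d e := by
    simp only [quasiForm, MvPolynomial.C_pow]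
  obtain ⟨n, hn⟩ := resultant_X_pow_sub_dvd (hC hα) (hC hβ) (mul_ne_zero hd hj)
    (mul_ne_zero he hj) (u := MvPolynomial.X 0) (v := MvPolynomial.X 1)
    (by rw [hG']; exact quasiForm_ne_zero hβ hd)
  rw [hG'] at hn
  have hα' : IsUnit (MvPolynomial.C α : MvPolynomial (Fin 2) k) :=
    (isUnit_iff_ne_zero.mpr hα).map MvPolynomial.C
  have hr0 := ne_zero_of_dvd_ne_zero
    (mul_ne_zero (pow_ne_zero n (hC hα)) (pow_ne_zero (d * j) (quasiForm_ne_zero hβ hd))) hn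
  have hdp : (p.map (MvPolynomial.C : k →+* MvPolynomial (Fin 2) k)).natDegree = d * j := by
    rw [natDegree_map_eq_of_injective (MvPolynomial.C_injective _ _), hp]
  have hdq : (q.map (MvPolynomial.C : k →+* MvPolynomial (Fin 2) k)).natDegree = e * j := by
    rw [natDegree_map_eq_of_injective (MvPolynomial.C_injective _ _), hq]
  have hlp : (p.map (MvPolynomial.C : k →+* MvPolynomial (Fin 2) k)).leadingCoeff =
      MvPolynomial.C α := leadingCoeff_map_of_injective (MvPolynomial.C_injective _ _) _
  have hlq : (q.map (MvPolynomial.C : k →+* MvPolynomial (Fin 2) k)).leadingCoeff =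
      MvPolynomial.C β := leadingCoeff_map_of_injective (MvPolynomial.C_injective _ _) _
  have htop : topForm d e (curveResultant p q (d * j) (e * j)) =
      resultant (C (MvPolynomial.C α) * X ^ (d * j) - C (MvPolynomial.X 0))
        (C (MvPolynomial.C β) * X ^ (e * j) - C (MvPolynomial.X 1)) (d * j) (e * j) := by
    rw [topForm, weightMap_curveResultant, leadingCoeff_weighted_resultant hj hdp hdq, hlp, hlq]
    rw [hlp, hlq]
    exact hr0
  refine ⟨fun h0 => hr0 ?_, d * j, ?_⟩
  · rw [← htop, h0, topForm, map_zero, HahnSeries.leadingCoeff_zero]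
  · rw [htop]
    refine ((hα'.pow n).dvd_mul_left.mp hn).trans (pow_dvd_pow_of_dvd ?_ _)
    have hAu : IsUnit (MvPolynomial.C (A ^ e) : MvPolynomial (Fin 2) k) :=
      (isUnit_iff_ne_zero.mpr (pow_ne_zero _ hA)).map MvPolynomial.C
    have hpq' : (MvPolynomial.C (B ^ d) * MvPolynomial.C (α ^ e) : MvPolynomial (Fin 2) k) =
        MvPolynomial.C (A ^ e) * MvPolynomial.C (β ^ d) := by
      rw [← MvPolynomial.C_mul, ← MvPolynomial.C_mul, hpq]
    have h1 : MvPolynomial.C (α ^ e) * quasiForm A B d e =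
        MvPolynomial.C (A ^ e) * quasiForm α β d e := by
      rw [quasiForm, quasiForm]
      linear_combination MvPolynomial.X 0 ^ e * hpq'
    have hαe : IsUnit (MvPolynomial.C (α ^ e) : MvPolynomial (Fin 2) k) :=
      (isUnit_iff_ne_zero.mpr (pow_ne_zero _ hα)).map MvPolynomial.C
    rw [← hαe.dvd_mul_left, h1]
    exact dvd_mul_left _ _

end QuasiHomogeneous

/-! ### Specialization at `x = 0`, generic zeros and curve equations -/

section LeadingForm
variable {k : Type*} [Field k]

theorem eval_zero_fiberResultant (P Q : MvPolynomial (Fin 2) k) (m n : ℕ) :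
    (fiberResultant P Q m n).eval 0 = curveResultant ((polyInY k P).map (evalRingHom 0))
      ((polyInY k Q).map (evalRingHom 0)) m n := by
  have h : ∀ (P : MvPolynomial (Fin 2) k) (i : Fin 2),
      (polyInYMap MvPolynomial.C P - C (C (MvPolynomial.X i))).map
        (evalRingHom (0 : MvPolynomial (Fin 2) k)) =
      ((polyInY k P).map (evalRingHom 0)).map MvPolynomial.C - C (MvPolynomial.X i) := by
    intro P i
    have hc : (evalRingHom (0 : MvPolynomial (Fin 2) k)).comp (mapRingHom MvPolynomial.C) =
        MvPolynomial.C.comp (evalRingHom 0) := by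
      ext <;> simp
    rw [Polynomial.map_sub, polyInYMap_eq_map, Polynomial.map_map, Polynomial.map_map, hc,
      Polynomial.map_C, coe_evalRingHom, eval_C]
  rw [← coe_evalRingHom, fiberResultant, ← resultant_map_map, h, h, curveResultant]

/-- At `x = 0` it becomes the equation of the curve `(P(0, y), Q(0, y))`, whose top form is nonzero.
-/
theorem fiberResultant_ne_zero {P Q : MvPolynomial (Fin 2) k} {K d e : ℕ} {A B : k} (hK : K ≠ 0)
    (hd : d ≠ 0) (he : e ≠ 0) (hA : A ≠ 0) (hB : B ≠ 0)
    (hPy : (polyInY k P).natDegree = K * d) (hPA : (polyInY k P).leadingCoeff = C A)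
    (hQy : (polyInY k Q).natDegree = K * e) (hQB : (polyInY k Q).leadingCoeff = C B) :
    fiberResultant P Q (K * d) (K * e) ≠ 0 := by
  have h : ∀ {P : MvPolynomial (Fin 2) k} {A : k}, A ≠ 0 → (polyInY k P).leadingCoeff = C A →
      ((polyInY k P).map (evalRingHom 0)).natDegree = (polyInY k P).natDegree ∧
      ((polyInY k P).map (evalRingHom 0)).leadingCoeff = A := by
    intro P A hA hPA
    have h1 : evalRingHom 0 (polyInY k P).leadingCoeff = A := by simp [hPA]
    have h2 : evalRingHom 0 (polyInY k P).leadingCoeff ≠ 0 := by rwa [h1]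
    exact ⟨natDegree_map_of_leadingCoeff_ne_zero _ h2,
      by rw [leadingCoeff_map_of_leadingCoeff_ne_zero _ h2, h1]⟩
  intro h0
  refine (topForm_curveResultant hA hd he hK (p := (polyInY k P).map (evalRingHom 0))
    (q := (polyInY k Q).map (evalRingHom 0)) ?_ ?_ (B := B) ?_).1 ?_
  · rw [(h hA hPA).1, hPy, mul_comm]
  · rw [(h hB hQB).1, hQy, mul_comm]
  · rw [(h hA hPA).2, (h hB hQB).2, mul_comm]
  · rw [mul_comm d, mul_comm e, ← eval_zero_fiberResultant, h0, eval_zero]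

/-- The resultant is a combination of `p - u` and `q - v`, and both vanish at `T = ξ`. -/
theorem eval_curveResultant_eq_zero {κ : Type*} [Field κ] (f : k →+* κ) {p q : k[X]} {m n : ℕ}
    (hm : m ≠ 0) (hp : p.natDegree = m) (hq : q.natDegree = n) (ξ : κ) :
    MvPolynomial.eval₂Hom f ![p.eval₂ f ξ, q.eval₂ f ξ] (curveResultant p q m n) = 0 := by
  obtain ⟨a, b, -, -, hab⟩ := exists_mul_add_mul_eq_C_resultant
    (p.map MvPolynomial.C - C (MvPolynomial.X 0 : MvPolynomial (Fin 2) k))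
    (q.map MvPolynomial.C - C (MvPolynomial.X 1)) (m := m) (n := n)
    (by rw [natDegree_sub_C]; exact natDegree_map_le.trans hp.le)
    (by rw [natDegree_sub_C]; exact natDegree_map_le.trans hq.le) (Or.inl hm)
  set φ := MvPolynomial.eval₂Hom f ![p.eval₂ f ξ, q.eval₂ f ξ] with hφ
  have hφC : φ.comp MvPolynomial.C = f := RingHom.ext fun a => MvPolynomial.eval₂Hom_C _ _ _
  have h0 : φ (MvPolynomial.X 0) = p.eval₂ f ξ := MvPolynomial.eval₂Hom_X' _ _ _
  have h1 : φ (MvPolynomial.X 1) = q.eval₂ f ξ := MvPolynomial.eval₂Hom_X' _ _ _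
  have := congrArg (Polynomial.eval₂ φ ξ) hab
  rw [eval₂_add, eval₂_mul, eval₂_mul, eval₂_sub, eval₂_sub, eval₂_map, eval₂_map, eval₂_C,
    eval₂_C, eval₂_C, hφC, h0, h1, sub_self, sub_self, zero_mul, zero_mul, zero_add] at this
  exact this.symm

/-- A prime polynomial has a generic zero over an algebraically closed field. -/
theorem exists_generic_zero {k : Type} [Field k] {F : MvPolynomial (Fin 2) k} (hF : Prime F) :
    ∃ (κ : Type) (_ : Field κ) (_ : IsAlgClosed κ) (_ : Algebra k κ) (u v : κ),
      ∀ H, MvPolynomial.eval₂Hom (algebraMap k κ) ![u, v] H = 0 ↔ F ∣ H := by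
  have hI : (Ideal.span {F}).IsPrime := (Ideal.span_singleton_prime hF.ne_zero).mpr hF
  let S := MvPolynomial (Fin 2) k ⧸ Ideal.span {F}
  let L := FractionRing S
  let φ : MvPolynomial (Fin 2) k →+* AlgebraicClosure L :=
    ((algebraMap L (AlgebraicClosure L)).comp (algebraMap S L)).comp (Ideal.Quotient.mk _)
  refine ⟨AlgebraicClosure L, inferInstance, inferInstance, (φ.comp MvPolynomial.C).toAlgebra,
    φ (MvPolynomial.X 0), φ (MvPolynomial.X 1), fun H => ?_⟩
  have hφ : MvPolynomial.eval₂Hom (φ.comp MvPolynomial.C)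
      ![φ (MvPolynomial.X 0), φ (MvPolynomial.X 1)] = φ := by
    refine MvPolynomial.ringHom_ext (fun a => MvPolynomial.eval₂Hom_C _ _ _) fun i => ?_
    rw [MvPolynomial.eval₂Hom_X']
    fin_cases i <;> rfl
  rw [RingHom.algebraMap_toAlgebra, hφ]
  simp only [φ, RingHom.comp_apply]
  rw [map_eq_zero, map_eq_zero_iff _ (IsFractionRing.injective S L), Ideal.Quotient.eq_zero_iff_mem,
    Ideal.mem_span_singleton]

/-- Each divisibility kills the degree in the other variable. This excludes a generic zero with both
coordinates in `k`. -/
theorem isUnit_of_dvd_X_sub_C {F : MvPolynomial (Fin 2) k} {a b : k}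
    (h0 : F ∣ MvPolynomial.X 0 - MvPolynomial.C a) (h1 : F ∣ MvPolynomial.X 1 - MvPolynomial.C b) :
    IsUnit F := by
  have hX : ∀ (i : Fin 2) (c : k),
      (MvPolynomial.X i - MvPolynomial.C c : MvPolynomial (Fin 2) k) ≠ 0 := by
    intro i c h
    have := congrArg (MvPolynomial.eval fun _ => c + 1) h
    simp at this
  have hdeg : ∀ (i l : Fin 2) (c : k), i ≠ l → F ∣ MvPolynomial.X i - MvPolynomial.C c →
      F.degreeOf l = 0 := by
    rintro i l c hil ⟨w, hw⟩
    have hFw : F * w ≠ 0 := hw ▸ hX i c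
    have h2 := MvPolynomial.degreeOf_mul_eq (n := l) (left_ne_zero_of_mul hFw)
      (right_ne_zero_of_mul hFw)
    have h3 := MvPolynomial.degreeOf_sub_le l (MvPolynomial.X i) (MvPolynomial.C c)
    rw [hw, h2, MvPolynomial.degreeOf_C, MvPolynomial.degreeOf_X, if_neg hil.symm] at h3
    simp at h3
    exact h3.1
  have hF0 : F ≠ 0 := ne_zero_of_dvd_ne_zero (hX 0 a) h0
  have hF : F = MvPolynomial.C (F.coeff 0) := by
    ext m
    rw [MvPolynomial.coeff_C]
    split_ifs with hm
    · rw [hm]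
    · by_contra hne
      refine hm ?_
      have hms := MvPolynomial.mem_support_iff.mpr hne
      ext l
      have := MvPolynomial.monomial_le_degreeOf l hms
      fin_cases l
      · rw [hdeg 1 _ b (by decide) h1] at this
        exact (Nat.le_zero.mp this).symm
      · rw [hdeg 0 _ a (by decide) h0] at this
        exact (Nat.le_zero.mp this).symm
  rw [hF]
  refine (isUnit_iff_ne_zero.mpr fun h => hF0 ?_).map MvPolynomial.C
  rw [hF, h, map_zero]

end LeadingForm

/-! ### The top form of the leading coefficient -/

section LeadingCoefficient
variable {k : Type} [Field k] [IsAlgClosed k] [CharZero k] [Algebra ℝ k]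
  {P Q : MvPolynomial (Fin 2) k} {K d e : ℕ} {A B : k}

/-- The top form of an irreducible factor of the leading coefficient of the resultant. -/
theorem topForm_dvd_of_irreducible
    (hJ : ∃ c : k, MvPolynomial.pderiv 0 P * MvPolynomial.pderiv 1 Q -
      MvPolynomial.pderiv 1 P * MvPolynomial.pderiv 0 Q = MvPolynomial.C c)
    (hK : K ≠ 0) (hd : d ≠ 0) (he : e ≠ 0) (hde : d.Coprime e) (hA : A ≠ 0) (hB : B ≠ 0)
    (hPy : (polyInY k P).natDegree = K * d) (hPA : (polyInY k P).leadingCoeff = C A)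
    (hQy : (polyInY k Q).natDegree = K * e) (hQB : (polyInY k Q).leadingCoeff = C B)
    {F : MvPolynomial (Fin 2) k} (hF : Irreducible F)
    (hFR : F ∣ (fiberResultant P Q (K * d) (K * e)).leadingCoeff) :
    ∃ n, topForm d e F ∣ quasiForm A B d e ^ n := by
  obtain ⟨κ, _, _, _, u, v, hκ⟩ := exists_generic_zero hF.prime
  have hX : ∀ (i : Fin 2) (a : k), MvPolynomial.eval₂Hom (algebraMap k κ) ![u, v]
      (MvPolynomial.X i - MvPolynomial.C a) = ![u, v] i - algebraMap k κ a := by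
    intro i a
    rw [map_sub, MvPolynomial.eval₂Hom_X', MvPolynomial.eval₂Hom_C]
  have huv : ¬ (u ∈ (algebraMap k κ).range ∧ v ∈ (algebraMap k κ).range) := by
    rintro ⟨⟨a, ha⟩, ⟨b, hb⟩⟩
    refine hF.not_isUnit (isUnit_of_dvd_X_sub_C (a := a) (b := b) ((hκ _).mp ?_) ((hκ _).mp ?_))
    · rw [hX, ha]; exact sub_self u
    · rw [hX, hb]; exact sub_self v
  have hR := fiberResultant_ne_zero hK hd he hA hB hPy hPA hQy hQB
  rw [← hPy, ← hQy] at hR hFR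
  obtain ⟨y, hP, hPu, hQ, hQv⟩ := exists_branch_at_infinity hA hB hPA hQB huv hR ((hκ _).mpr hFR)
  rw [← hPu, ← hQv] at huv
  obtain ⟨ξ, p, q, j, hj, hp, hq, hpq, hpξ, hqξ⟩ :=
    exists_polynomial_curve hJ hd he hde hA hB hPy hPA hQy hQB hP hQ huv
  obtain ⟨-, n, hn⟩ := topForm_curveResultant hA hd he hj hp hq hpq
  have hE := eval_curveResultant_eq_zero (algebraMap k κ) (mul_ne_zero hd hj) hp hq ξ
  rw [← aeval_def, ← aeval_def, hpξ, hqξ, hPu, hQv, hκ] at hE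
  obtain ⟨w, hw⟩ := hE
  rw [hw, topForm_mul] at hn
  exact ⟨n, (dvd_mul_right _ _).trans hn⟩

theorem exists_leadingCoeff_fiberResultant
    (hJ : ∃ c : k, MvPolynomial.pderiv 0 P * MvPolynomial.pderiv 1 Q -
      MvPolynomial.pderiv 1 P * MvPolynomial.pderiv 0 Q = MvPolynomial.C c)
    (hK : K ≠ 0) (hd : d ≠ 0) (he : e ≠ 0) (hde : d.Coprime e) (hA : A ≠ 0) (hB : B ≠ 0)
    (hPy : (polyInY k P).natDegree = K * d) (hPA : (polyInY k P).leadingCoeff = C A)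
    (hQy : (polyInY k Q).natDegree = K * e) (hQB : (polyInY k Q).leadingCoeff = C B) :
    ∃ (c : k) (M : ℕ) (S : MvPolynomial (Fin 2) k), c ≠ 0 ∧
      (∀ s ∈ S.support, s 0 * d + s 1 * e < M * d * e) ∧
      (fiberResultant P Q (K * d) (K * e)).leadingCoeff =
        MvPolynomial.C c * quasiForm A B d e ^ M + S := by
  set R := (fiberResultant P Q (K * d) (K * e)).leadingCoeff with hRdef
  have hR : R ≠ 0 := leadingCoeff_ne_zero.mpr
    (fiberResultant_ne_zero hK hd he hA hB hPy hPA hQy hQB)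
  have key : ∀ F, F ∣ R → ∃ n, topForm d e F ∣ quasiForm A B d e ^ n := by
    intro F
    induction F using WfDvdMonoid.induction_on_irreducible with
    | zero => intro h; exact absurd (zero_dvd_iff.mp h) hR
    | unit u hu =>
      intro _
      obtain ⟨r, hr, rfl⟩ := MvPolynomial.isUnit_iff_eq_C_of_isReduced.mp hu
      rw [topForm_C]
      exact ⟨0, hu.dvd⟩
    | mul a i _ hi ih =>
      intro h
      obtain ⟨m, hm⟩ := ih ((dvd_mul_left _ _).trans h)
      obtain ⟨n, hn⟩ := topForm_dvd_of_irreducible hJ hK hd he hde hA hB hPy hPA hQy hQB hi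
        ((dvd_mul_right _ _).trans h)
      exact ⟨n + m, by rw [topForm_mul, pow_add]; exact mul_dvd_mul hn hm⟩
  obtain ⟨n, hn⟩ := key R dvd_rfl
  obtain ⟨M, -, hM⟩ := (dvd_prime_pow (quasiForm_prime hA hB hd he hde) n).mp hn
  obtain ⟨w, hw⟩ := hM.symm
  obtain ⟨c, hc, hcw⟩ := MvPolynomial.isUnit_iff_eq_C_of_isReduced.mp w.isUnit
  rw [hcw, mul_comm] at hw
  -- The binomial is homogeneous of weight `d e`, so the top weight is `M d e`, the strict bound for
  -- the remainder.
  have hord : (weightMap k d e R).order = -(M * (d * e) : ℝ) := by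
    have h1 : weightMap k d e (topForm d e R) =
        HahnSeries.single (-(M * (d * e) : ℝ)) (topForm d e R) := by
      rw [← hw, map_mul, map_pow (weightMap k d e), weightMap_C, weightMap_quasiForm,
        HahnSeries.single_pow, HahnSeries.single_mul_single, nsmul_eq_mul, zero_add, mul_neg]
    obtain ⟨m, hm⟩ := MvPolynomial.ne_zero_iff.mp (topForm_ne_zero d e hR)
    have h2 := coeff_topForm d e R m
    have h3 : (weightMap k d e R).order = -(d * m 0 + e * m 1 : ℝ) := by
      by_contra hne
      rw [if_neg hne] at h2
      exact hm h2
    have h4 := coeff_coeff_weightMap d e (topForm d e R) (-(d * m 0 + e * m 1 : ℝ)) m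
    rw [if_pos rfl, h1] at h4
    rw [h3]
    by_contra hne
    rw [HahnSeries.coeff_single_of_ne hne, MvPolynomial.coeff_zero] at h4
    exact hm h4.symm
  refine ⟨c, M, R - topForm d e R, hc.ne_zero, fun s hs => ?_, by rw [hw]; ring⟩
  have := weight_lt_of_mem_support_sub_topForm hs
  rw [hord, neg_neg] at this
  have h2 : d * s 0 + e * s 1 < M * (d * e) := by exact_mod_cast this
  linarith

end LeadingCoefficient

/-! ### Comparison with the definitions in the statement -/

section Translation

theorem asPolyInY_eq_polyInYMap (S : Type*) [CommRing S] [Algebra ℂ S]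
    (P : MvPolynomial (Fin 2) ℂ) : asPolyInY S P = polyInYMap (algebraMap ℂ S) P := by
  rw [asPolyInY, MvPolynomial.aeval_def, polyInYMap]
  rfl

theorem asPolyInY_eq_polyInY (P : MvPolynomial (Fin 2) ℂ) : asPolyInY ℂ P = polyInY ℂ P := by
  rw [asPolyInY, MvPolynomial.aeval_def, polyInY]
  rfl

/-- By default the resultant uses the actual degrees, and these survive both base change and
subtraction of a constant. -/
theorem resultantY_eq_fiberResultant {P Q : MvPolynomial (Fin 2) ℂ} {m n : ℕ}
    (hP : (polyInY ℂ P).natDegree = m) (hQ : (polyInY ℂ Q).natDegree = n) :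
    resultantY P Q = fiberResultant P Q m n := by
  have h : ∀ (P : MvPolynomial (Fin 2) ℂ) (i : Fin 2),
      (polyInYMap (MvPolynomial.C : ℂ →+* MvPolynomial (Fin 2) ℂ) P -
        C (C (MvPolynomial.X i))).natDegree = (polyInY ℂ P).natDegree := by
    intro P i
    rw [natDegree_sub_C, polyInYMap_eq_map]
    exact natDegree_map_eq_of_injective (map_injective _ (MvPolynomial.C_injective _ _)) _
  rw [resultantY, asPolyInY_eq_polyInYMap, asPolyInY_eq_polyInYMap, MvPolynomial.algebraMap_eq,
    h, h, hP, hQ, fiberResultant]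

theorem polyInY_injective (k : Type*) [Field k] : Function.Injective (polyInY k) := by
  let ψ : k[X][X] →+* MvPolynomial (Fin 2) k :=
    eval₂RingHom (eval₂RingHom MvPolynomial.C (MvPolynomial.X 0)) (MvPolynomial.X 1)
  refine Function.LeftInverse.injective (g := ψ) fun P => ?_
  induction P using MvPolynomial.induction_on with
  | C a => simp [polyInY, ψ]
  | add p q hp hq => rw [map_add, map_add, hp, hq]
  | mul_X p i hp =>
    rw [map_mul, map_mul, hp]
    congr 1
    fin_cases i <;> simp [polyInY, ψ]

theorem pderiv_eq_zero_of_natDegree_polyInY {k : Type*} [Field k] {P : MvPolynomial (Fin 2) k}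
    {A : k} (hP : (polyInY k P).natDegree = 0) (hPA : (polyInY k P).leadingCoeff = C A) (i : Fin 2) :
    MvPolynomial.pderiv i P = 0 := by
  have h : P = MvPolynomial.C A := by
    apply polyInY_injective k
    rw [eq_C_of_natDegree_eq_zero hP, ← hP, coeff_natDegree, hPA]
    simp [polyInY]
  rw [h, MvPolynomial.pderiv_C]

end Translation

end

theorem corollary1 (P Q : MvPolynomial (Fin 2) ℂ) (K d e : ℕ) (A B : ℂ)
    (hJ : ∃ c : ℂ, c ≠ 0 ∧ jacobianDet P Q = MvPolynomial.C c)
    (hPdeg : P.totalDegree = K * d) (hQdeg : Q.totalDegree = K * e)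
    (hde : Nat.gcd d e = 1)
    (hA : A ≠ 0) (hB : B ≠ 0)
    (hPy : (asPolyInY ℂ P).natDegree = K * d)
    (hPA : (asPolyInY ℂ P).leadingCoeff = Polynomial.C A)
    (hQy : (asPolyInY ℂ Q).natDegree = K * e)
    (hQB : (asPolyInY ℂ Q).leadingCoeff = Polynomial.C B) :
    ∃ (C : ℂ) (M : ℕ) (S : MvPolynomial (Fin 2) ℂ),
      C ≠ 0 ∧
      (∀ s ∈ S.support, s 0 * d + s 1 * e < M * d * e) ∧
      (resultantY P Q).leadingCoeff =
        MvPolynomial.C C *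
          (MvPolynomial.C (B ^ d) * MvPolynomial.X 0 ^ e
            - MvPolynomial.C (A ^ e) * MvPolynomial.X 1 ^ d) ^ M + S := by
  obtain ⟨c, hc, hJ⟩ := hJ
  rw [jacobianDet] at hJ
  rw [asPolyInY_eq_polyInY] at hPy hPA hQy hQB
  have hC : (MvPolynomial.C c : MvPolynomial (Fin 2) ℂ) ≠ 0 :=
    (map_ne_zero_iff _ (MvPolynomial.C_injective _ _)).mpr hc
  -- Degree zero in `y` with constant leading coefficient makes the polynomial constant, hence the
  -- Jacobian zero.
  have hKd : K * d ≠ 0 := by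
    intro h
    have h0 := pderiv_eq_zero_of_natDegree_polyInY (hPy.trans h) hPA
    rw [h0, h0, zero_mul, zero_mul, sub_zero] at hJ
    exact hC hJ.symm
  have hKe : K * e ≠ 0 := by
    intro h
    have h0 := pderiv_eq_zero_of_natDegree_polyInY (hQy.trans h) hQB
    rw [h0, h0, mul_zero, mul_zero, sub_zero] at hJ
    exact hC hJ.symm
  rw [resultantY_eq_fiberResultant hPy hQy]
  exact exists_leadingCoeff_fiberResultant ⟨c, hJ⟩ (left_ne_zero_of_mul hKd)
    (right_ne_zero_of_mul hKd) (right_ne_zero_of_mul hKe) hde hA hB hPy hPA hQy hQB
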